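/- A *dagger prop* is a strict symmetric monoidal dagger category whose objects are the natural numbers, with tensor product of objects given by addition and with unitary braiding; write $+$ for the tensor product of morphisms and $B_{m,n}\colon m+n\to n+m$ for the braiding. A *morphism of dagger props* is a strict symmetric monoidal functor that is the identity on objects and commutes with the daggers. *Bond graphs.* Let $\mathrm{BondGraph}$ be the prop generated by morphisms $M\colon 2\to 1$, $I\colon 0\to 1$, $D\colon 1\to 2$, $E\colon 1\to 0$ (1-junctions) and $M'\colon 2\to 1$, $I'\colon 0\to 1$, $D'\colon 1\to 2$, $E'\colon 1\to 0$ (0-junctions), subject to the following equations. - $(1,M,I,D,E)$ and $(1,M',I',D',E')$ are extraspecial symmetric Frobenius monoids. Here $(1,\mu,\iota,\delta,\epsilon)$ is such if $(1,\mu,\iota)$ is a monoid, $(1,\delta,\epsilon)$ is a comonoid, $(\mathrm{id}_1+\mu)(\delta+\mathrm{id}_1)=\delta\mu=(\mu+\mathrm{id}_1)(\mathrm{id}_1+\delta)$, $\mu\delta=\mathrm{id}_1$, $\epsilon\iota=\mathrm{id}_0$ and $\epsilon\mu B_{1,1}=\epsilon\mu$ (equivalently $B_{1,1}\delta\iota=\delta\iota$).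 - $(1,M,I,D',E')$ and $(1,M',I',D,E)$ are weak bimonoids. Here a monoid $(1,\mu,\iota)$ and a comonoid $(1,\delta,\epsilon)$ form a weak bimonoid if $$\delta\mu=(\mu+\mu)(\mathrm{id}_1+B_{1,1}+\mathrm{id}_1)(\delta+\delta),$$ $$\epsilon\mu(\mu+\mathrm{id}_1)=(\epsilon\mu+\epsilon\mu)(\mathrm{id}_1+\delta+\mathrm{id}_1)=(\epsilon\mu+\epsilon\mu)(\mathrm{id}_1+B_{1,1}\delta+\mathrm{id}_1),$$ $$(\delta+\mathrm{id}_1)\delta\iota=(\mathrm{id}_1+\mu+\mathrm{id}_1)(\delta\iota+\delta\iota)=(\mathrm{id}_1+\mu B_{1,1}+\mathrm{id}_1)(\delta\iota+\delta\iota).$$ - $EI'=\mathrm{id}_0=E'I$. - $(M'DMD')^2=M'DMD'$ and $(MD'M'D)^2=MD'M'D$. It is a dagger prop with the dagger determined by $M^\dagger=D$, $I^\dagger=E$, $M'^\dagger=D'$, $I'^\dagger=E'$. *Corelations.* Let $\mathrm{FinCorel}$ be the dagger prop in which a morphism $m\to n$ is a partition of the disjoint union of an $m$-element set and an $n$-element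 set. Partitions are composed by gluing along the middle set (taking the finest common coarsening) and restricting to the outer sets, the tensor product is disjoint union, the braiding is the block swap, and the dagger exchanges source and target. Let $m\colon 2\to 1$, $i\colon 0\to 1$, $d\colon 1\to 2$, $e\colon 1\to 0$ be the partitions with a single part, and put $$m_2=\mathrm{id}_1+em+\mathrm{id}_1,\quad i_2=di,\quad d_2=\mathrm{id}_1+di+\mathrm{id}_1,\quad e_2=em,$$ $$\mu_2=(m+m)(\mathrm{id}_1+B_{1,1}+\mathrm{id}_1),\quad \iota_2=i+i,\quad \delta_2=(\mathrm{id}_1+B_{1,1}+\mathrm{id}_1)(d+d),\quad \epsilon_2=e+e.$$ These are two Frobenius structures on the object $2$. Let $\mathrm{FinCorel}^\circ$ be the symmetric monoidal dagger subcategory of $\mathrm{FinCorel}$ with objects $0,2,4,\dots$ generated by these eight morphisms. It is regarded as a dagger prop by calling the object $2n$ by the name $n$. *Lagrangian relations.* Let $k$ be a field. Let $\mathrm{LagRel}_k$ be the dagger prop in which a morphism $m\to n$ is a Lagrangian (that is, maximal isotropic) subspace of $\overline{(k\oplus k)^m}\oplus(k\oplus k)^n$. Here $(k\oplus k)^n$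 carries the sum of $n$ copies of the form $\omega((\phi,J),(\phi',J'))=\phi J'-\phi'J$, and the bar denotes the sign change of the form. Composition is relational composition, the tensor product is direct sum, the braiding is the block swap, and the dagger is the opposite relation. Consider the linear relations $+\colon k\oplus k\to k$ (addition), $0\colon\{0\}\to k$ (zero), $\Delta\colon k\to k\oplus k$ (duplication), $!\colon k\to\{0\}$ (deletion) and their opposites, marked by $\dagger$. For linear relations $R,S$ from $k^m$ to $k^n$, let $R\oplus S$ be the relation from $(k\oplus k)^m$ to $(k\oplus k)^n$ that relates the first components (efforts) by $R$ and the second components (flows) by $S$. Let $\mathrm{LagRel}_k^\circ$ be the sub-prop of $\mathrm{LagRel}_k$ generated by $+\oplus\Delta^\dagger$, $0\oplus{!}^\dagger$, $+^\dagger\oplus\Delta$, $0^\dagger\oplus{!}$, $\Delta^\dagger\oplus+$, ${!}^\dagger\oplus 0$, $\Delta\oplus+^\dagger$ and ${!}\oplus 0^\dagger$, with the dagger of $\mathrm{LagRel}_k$. **Proposition.** There is a unique morphism of dagger props $G\colon\mathrm{BondGraph}\to\mathrm{FinCorel}^\circ$ with $$G(M)=m_2,\quad G(I)=i_2,\quad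 G(M')=\mu_2,\quad G(I')=\iota_2,$$ and, for every field $k$, there is a unique morphism of dagger props $F\colon\mathrm{BondGraph}\to\mathrm{LagRel}_k^\circ$ with $$F(M)=+\oplus\Delta^\dagger,\quad F(I)=0\oplus{!}^\dagger,\quad F(M')=\Delta^\dagger\oplus+,\quad F(I')={!}^\dagger\oplus 0.$$ -/

import Mathlib

/-!
Conventions.  `comp f g` is written in diagrammatic order: first `f`, then `g`, so it is the
composite `g ∘ f`.
-/

universe u v

namespace BondGraphs

/-! ### Dagger props -/

/-- The operations of a dagger prop: a category whose objects are the natural numbers, with a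
tensor product that is addition on objects, a braiding and a dagger. -/
structure DaggerPropData where
  Hom : ℕ → ℕ → Type u
  id : ∀ n, Hom n n
  comp : ∀ {m n p}, Hom m n → Hom n p → Hom m p
  tensor : ∀ {m n p q}, Hom m n → Hom p q → Hom (m + p) (n + q)
  braid : ∀ m n, Hom (m + n) (n + m)
  dagger : ∀ {m n}, Hom m n → Hom n m

/-- Transport of a morphism along equalities between its source, resp. target, objects. -/
def DaggerPropData.cast (P : DaggerPropData.{u}) {m n m' n' : ℕ} (h : m = m') (h' : n = n')
    (f : P.Hom m n) : P.Hom m' n' := h ▸ h' ▸ f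

/-- A dagger prop: a strict symmetric monoidal dagger category with objects the natural numbers
and tensor product of objects given by addition.  Strictness means that associators and unitors
are identities, i.e. that the two sides of `tensor_assoc`, `id_tensor`, `tensor_id_zero` agree
after transport along the equalities `m + n + p = m + (n + p)`, `0 + m = m`, `m + 0 = m` of
objects. -/
structure DaggerProp extends DaggerPropData.{u} where
  id_comp : ∀ {m n} (f : Hom m n), comp (id m) f = f
  comp_id : ∀ {m n} (f : Hom m n), comp f (id n) = f
  comp_assoc : ∀ {m n p q} (f : Hom m n) (g : Hom n p) (h : Hom p q),
    comp (comp f g) h = comp f (comp g h)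
  id_tensor_id : ∀ m n, tensor (id m) (id n) = id (m + n)
  interchange : ∀ {m n p m' n' p'} (f : Hom m n) (g : Hom n p) (f' : Hom m' n') (g' : Hom n' p'),
    tensor (comp f g) (comp f' g') = comp (tensor f f') (tensor g g')
  tensor_assoc : ∀ {m n p q r s} (f : Hom m n) (g : Hom p q) (h : Hom r s),
    toDaggerPropData.cast (Nat.add_assoc m p r) (Nat.add_assoc n q s) (tensor (tensor f g) h)
      = tensor f (tensor g h)
  id_tensor : ∀ {m n} (f : Hom m n),
    toDaggerPropData.cast (Nat.zero_add m) (Nat.zero_add n) (tensor (id 0) f) = f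
  tensor_id_zero : ∀ {m n} (f : Hom m n),
    toDaggerPropData.cast (Nat.add_zero m) (Nat.add_zero n) (tensor f (id 0)) = f
  braid_natural : ∀ {m n p q} (f : Hom m n) (g : Hom p q),
    comp (tensor f g) (braid n q) = comp (braid m p) (tensor g f)
  braid_braid : ∀ m n, comp (braid m n) (braid n m) = id (m + n)
  hexagon : ∀ m n p,
    toDaggerPropData.cast (Nat.add_assoc m n p) (Nat.add_assoc n p m).symm
      (comp (tensor (braid m n) (id p))
        (toDaggerPropData.cast (Nat.add_assoc n m p).symm rfl (tensor (id n) (braid m p))))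
      = braid m (n + p)
  hexagon' : ∀ m n p,
    toDaggerPropData.cast (Nat.add_assoc m n p).symm (Nat.add_assoc p m n)
      (comp (tensor (id m) (braid n p))
        (toDaggerPropData.cast (Nat.add_assoc m p n) rfl (tensor (braid m p) (id n))))
      = braid (m + n) p
  dagger_id : ∀ n, dagger (id n) = id n
  dagger_comp : ∀ {m n p} (f : Hom m n) (g : Hom n p),
    dagger (comp f g) = comp (dagger g) (dagger f)
  dagger_dagger : ∀ {m n} (f : Hom m n), dagger (dagger f) = f
  dagger_tensor : ∀ {m n p q} (f : Hom m n) (g : Hom p q),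
    dagger (tensor f g) = tensor (dagger f) (dagger g)
  /-- The braiding is unitary: its dagger is its inverse, see `braid_braid`. -/
  dagger_braid : ∀ m n, dagger (braid m n) = braid n m

/-- A morphism of dagger props: a strict symmetric monoidal functor that is the identity on
objects and commutes with the daggers. -/
structure DaggerPropHom (P : DaggerProp.{u}) (Q : DaggerProp.{v}) where
  map : ∀ {m n}, P.toDaggerPropData.Hom m n → Q.toDaggerPropData.Hom m n
  map_id : ∀ n, map (P.id n) = Q.id n
  map_comp : ∀ {m n p} (f : P.toDaggerPropData.Hom m n) (g : P.toDaggerPropData.Hom n p),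
    map (P.comp f g) = Q.comp (map f) (map g)
  map_tensor : ∀ {m n p q} (f : P.toDaggerPropData.Hom m n) (g : P.toDaggerPropData.Hom p q),
    map (P.tensor f g) = Q.tensor (map f) (map g)
  map_braid : ∀ m n, map (P.braid m n) = Q.braid m n
  map_dagger : ∀ {m n} (f : P.toDaggerPropData.Hom m n), map (P.dagger f) = Q.dagger (map f)

/-! Transport along equalities of objects. -/

section Cast

variable (P : DaggerPropData.{u})

theorem cast_rfl {m n : ℕ} (f : P.Hom m n) : P.cast rfl rfl f = f := rfl

theorem cast_cast {m n m' n' m'' n'' : ℕ} (h : m = m') (h' : n = n') (k : m' = m'') (k' : n' = n'')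
    (f : P.Hom m n) : P.cast k k' (P.cast h h' f) = P.cast (h.trans k) (h'.trans k') f := by
  subst h h' k k'; rfl

theorem comp_cast_cast {m n p m' n' p' : ℕ} (h : m = m') (h' : n = n') (h'' : p = p')
    (f : P.Hom m n) (g : P.Hom n p) :
    P.comp (P.cast h h' f) (P.cast h' h'' g) = P.cast h h'' (P.comp f g) := by
  subst h h' h''; rfl

theorem tensor_cast_cast {m n p q m' n' p' q' : ℕ} (h : m = m') (h' : n = n') (k : p = p')
    (k' : q = q') (f : P.Hom m n) (g : P.Hom p q) :
    P.tensor (P.cast h h' f) (P.cast k k' g)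
      = P.cast (congrArg₂ (· + ·) h k) (congrArg₂ (· + ·) h' k') (P.tensor f g) := by
  subst h h' k k'; rfl

theorem dagger_cast {m n m' n' : ℕ} (h : m = m') (h' : n = n') (f : P.Hom m n) :
    P.dagger (P.cast h h' f) = P.cast h' h (P.dagger f) := by
  subst h h'; rfl

end Cast

/-- Operations that embed faithfully, and compatibly with all operations, in a dagger prop
satisfy the laws of a dagger prop. -/
def DaggerPropData.ofEmbedding (D : DaggerPropData.{u}) (P : DaggerProp.{v})
    (φ : ∀ {m n}, D.Hom m n → P.toDaggerPropData.Hom m n)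
    (inj : ∀ {m n} {f g : D.Hom m n}, φ f = φ g → f = g)
    (φ_id : ∀ n, φ (D.id n) = P.id n)
    (φ_comp : ∀ {m n p} (f : D.Hom m n) (g : D.Hom n p),
      φ (D.comp f g) = P.comp (φ f) (φ g))
    (φ_tensor : ∀ {m n p q} (f : D.Hom m n) (g : D.Hom p q),
      φ (D.tensor f g) = P.tensor (φ f) (φ g))
    (φ_braid : ∀ m n, φ (D.braid m n) = P.braid m n)
    (φ_dagger : ∀ {m n} (f : D.Hom m n), φ (D.dagger f) = P.dagger (φ f)) :
    DaggerProp.{u} :=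
  have φ_cast : ∀ {m n m' n' : ℕ} (h : m = m') (h' : n = n') (f : D.Hom m n),
      φ (D.cast h h' f) = P.cast h h' (φ f) := by
    intro m n m' n' h h' f; subst h h'; rfl
  { D with
    id_comp := fun f => inj (by rw [φ_comp, φ_id, P.id_comp])
    comp_id := fun f => inj (by rw [φ_comp, φ_id, P.comp_id])
    comp_assoc := fun f g h => inj (by simp only [φ_comp, P.comp_assoc])
    id_tensor_id := fun m n => inj (by simp only [φ_tensor, φ_id, P.id_tensor_id])
    interchange := fun f g f' g' => inj (by simp only [φ_tensor, φ_comp, P.interchange])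
    tensor_assoc := fun f g h => inj (by simp only [φ_cast, φ_tensor, P.tensor_assoc])
    id_tensor := fun f => inj (by simp only [φ_cast, φ_tensor, φ_id, P.id_tensor])
    tensor_id_zero := fun f => inj (by simp only [φ_cast, φ_tensor, φ_id, P.tensor_id_zero])
    braid_natural := fun f g => inj (by
      simp only [φ_comp, φ_tensor, φ_braid, P.braid_natural])
    braid_braid := fun m n => inj (by simp only [φ_comp, φ_braid, φ_id, P.braid_braid])
    hexagon := fun m n p => inj (by
      simp only [φ_cast, φ_comp, φ_tensor, φ_braid, φ_id, P.hexagon])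
    hexagon' := fun m n p => inj (by
      simp only [φ_cast, φ_comp, φ_tensor, φ_braid, φ_id, P.hexagon'])
    dagger_id := fun n => inj (by simp only [φ_dagger, φ_id, P.dagger_id])
    dagger_comp := fun f g => inj (by simp only [φ_dagger, φ_comp, P.dagger_comp])
    dagger_dagger := fun f => inj (by simp only [φ_dagger, P.dagger_dagger])
    dagger_tensor := fun f g => inj (by simp only [φ_dagger, φ_tensor, P.dagger_tensor])
    dagger_braid := fun m n => inj (by simp only [φ_dagger, φ_braid, P.dagger_braid]) }

/-! ### The dagger prop of multiples of an object -/

/-- The full symmetric monoidal dagger subcategory of `P` on the objects `0, c, 2c, 3c, …`,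
regarded as a prop by naming the object `c * n` by `n`. -/
def DaggerProp.multiplesData (P : DaggerProp.{u}) (c : ℕ) : DaggerPropData.{u} where
  Hom m n := P.toDaggerPropData.Hom (c * m) (c * n)
  id n := P.id (c * n)
  comp f g := P.comp f g
  tensor {m n p q} f g := P.cast (Nat.mul_add c m p).symm (Nat.mul_add c n q).symm (P.tensor f g)
  braid m n := P.cast (Nat.mul_add c m n).symm (Nat.mul_add c n m).symm
    (P.braid (c * m) (c * n))
  dagger f := P.dagger f

theorem DaggerProp.multiplesData_cast (P : DaggerProp.{u}) (c : ℕ) {m n m' n' : ℕ} (h : m = m')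
    (h' : n = n') (f : (P.multiplesData c).Hom m n) :
    (P.multiplesData c).cast h h' f
      = P.cast (congrArg (c * ·) h) (congrArg (c * ·) h') f := by
  subst h h'; rfl

theorem hexagon_cast (P : DaggerProp.{u}) {a b d x x' y z z' t t' s s' w w' : ℕ}
    (h1 : a + b = x) (h2 : b + a = x') (h3 : a + d = z) (h4 : d + a = z') (h5 : b + d = y)
    (h6 : x + d = t) (h7 : x' + d = t') (h8 : b + z = s) (h9 : b + z' = s')
    (h10 : a + y = w) (h11 : y + a = w') (h12 : s = t') (h13 : t = w) (h14 : s' = w') :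
    P.cast h13 h14 (P.comp (P.cast h6 h7 (P.tensor (P.cast h1 h2 (P.braid a b)) (P.id d)))
      (P.cast h12 rfl (P.cast h8 h9 (P.tensor (P.id b) (P.cast h3 h4 (P.braid a d))))))
    = P.cast h10 h11 (P.braid a y) := by
  subst h1 h2 h3 h4 h5 h6 h7 h8 h9 h10 h11
  exact P.hexagon a b d

theorem hexagon_cast' (P : DaggerProp.{u}) {a b d x x' y z z' t t' s s' w w' : ℕ}
    (h1 : b + d = x) (h2 : d + b = x') (h3 : a + d = z) (h4 : d + a = z') (h5 : a + b = y)
    (h6 : a + x = t) (h7 : a + x' = t') (h8 : z + b = s) (h9 : z' + b = s')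
    (h10 : y + d = w) (h11 : d + y = w') (h12 : s = t') (h13 : t = w) (h14 : s' = w') :
    P.cast h13 h14 (P.comp (P.cast h6 h7 (P.tensor (P.id a) (P.cast h1 h2 (P.braid b d))))
      (P.cast h12 rfl (P.cast h8 h9 (P.tensor (P.cast h3 h4 (P.braid a d)) (P.id b)))))
    = P.cast h10 h11 (P.braid y d) := by
  subst h1 h2 h3 h4 h5 h6 h7 h8 h9 h10 h11
  exact P.hexagon' a b d

/-- The dagger prop with the operations `DaggerProp.multiplesData`. -/
def DaggerProp.multiples (P : DaggerProp.{u}) (c : ℕ) : DaggerProp.{u} where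
  toDaggerPropData := P.multiplesData c
  id_comp f := P.id_comp _
  comp_id f := P.comp_id _
  comp_assoc f g h := P.comp_assoc _ _ _
  id_tensor_id m n := by
    simp only [multiplesData, P.id_tensor_id]
    generalize_proofs h
    revert h
    generalize c * (m + n) = a
    rintro rfl
    rfl
  interchange {m n p m' n' p'} f g f' g' :=
    (congrArg (P.cast _ _) (P.interchange (m := c * m) (n := c * n) (p := c * p) (m' := c * m')
      (n' := c * n') (p' := c * p') f g f' g')).trans (comp_cast_cast _ _ _ _ _ _).symm
  tensor_assoc {m n p q r s} f g h := by
    rw [multiplesData_cast]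
    simp only [multiplesData]
    have e1 := tensor_cast_cast P.toDaggerPropData (m := c * m + c * p) (n := c * n + c * q)
      (p := c * r) (q := c * s) (Nat.mul_add c _ _).symm (Nat.mul_add c _ _).symm
      rfl rfl (P.tensor f g) h
    have e2 := tensor_cast_cast P.toDaggerPropData (m := c * m) (n := c * n)
      (p := c * p + c * r) (q := c * q + c * s) rfl rfl (Nat.mul_add c _ _).symm
      (Nat.mul_add c _ _).symm f (P.tensor g h)
    refine (congrArg _ (congrArg _ e1)).trans (Eq.trans ?_ (congrArg _ e2).symm)
    refine Eq.trans ?_ (congrArg _ (congrArg _ (P.tensor_assoc (m := c * m) (n := c * n)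
      (p := c * p) (q := c * q) (r := c * r) (s := c * s) f g h)))
    simp only [cast_cast]
  id_tensor {m n} f := by
    rw [multiplesData_cast]
    simp only [multiplesData]
    rw [cast_cast]
    exact P.id_tensor (m := c * m) (n := c * n) f
  tensor_id_zero {m n} f := by
    rw [multiplesData_cast]
    simp only [multiplesData]
    rw [cast_cast]
    exact P.tensor_id_zero (m := c * m) (n := c * n) f
  braid_natural {m n p q} f g :=
    (comp_cast_cast _ _ _ _ _ _).trans ((congrArg (P.cast _ _) (P.braid_natural (m := c * m)
      (n := c * n) (p := c * p) (q := c * q) f g)).trans (comp_cast_cast _ _ _ _ _ _).symm)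
  braid_braid m n := by
    simp only [multiplesData, comp_cast_cast, P.braid_braid]
    generalize_proofs h
    revert h
    generalize c * (m + n) = a
    rintro rfl
    rfl
  hexagon m n p := by
    rw [multiplesData_cast, multiplesData_cast]
    exact hexagon_cast P _ _ _ _ (Nat.mul_add c _ _).symm _ _ _ _ _ _ _ _ _
  hexagon' m n p := by
    rw [multiplesData_cast, multiplesData_cast]
    exact hexagon_cast' P _ _ _ _ (Nat.mul_add c _ _).symm _ _ _ _ _ _ _ _ _
  dagger_id n := P.dagger_id _
  dagger_comp f g := P.dagger_comp _ _
  dagger_dagger f := P.dagger_dagger _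
  dagger_tensor {m n p q} f g := (dagger_cast _ _ _ _).trans (congrArg (P.cast _ _)
    (P.dagger_tensor (m := c * m) (n := c * n) (p := c * p) (q := c * q) f g))
  dagger_braid m n := by simp only [multiplesData, dagger_cast, P.dagger_braid]

/-! ### Sub-props generated by morphisms -/

/-- The morphisms of `P` that can be built from a family `S` of morphisms by composing and
tensoring with one another and with identities and braidings. -/
inductive DaggerProp.Generated (P : DaggerProp.{u})
    (S : ∀ m n, P.toDaggerPropData.Hom m n → Prop) :
    ∀ m n, P.toDaggerPropData.Hom m n → Prop
  | gen {m n} (f : P.toDaggerPropData.Hom m n) : S m n f → Generated P S m n f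
  | id (n) : Generated P S n n (P.id n)
  | braid (m n) : Generated P S (m + n) (n + m) (P.braid m n)
  | comp {m n p} (f : P.toDaggerPropData.Hom m n) (g : P.toDaggerPropData.Hom n p) :
      Generated P S m n f → Generated P S n p g → Generated P S m p (P.comp f g)
  | tensor {m n p q} (f : P.toDaggerPropData.Hom m n) (g : P.toDaggerPropData.Hom p q) :
      Generated P S m n f → Generated P S p q g →
      Generated P S (m + p) (n + q) (P.tensor f g)

theorem DaggerProp.Generated.dagger {P : DaggerProp.{u}}
    {S : ∀ m n, P.toDaggerPropData.Hom m n → Prop}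
    (hS : ∀ m n f, S m n f → S n m (P.dagger f)) {m n : ℕ} {f : P.toDaggerPropData.Hom m n}
    (hf : P.Generated S m n f) : P.Generated S n m (P.dagger f) := by
  induction hf with
  | gen f h => exact .gen _ (hS _ _ _ h)
  | id n => rw [P.dagger_id]; exact .id n
  | braid m n => rw [P.dagger_braid]; exact .braid n m
  | comp f g _ _ hf hg => rw [P.dagger_comp]; exact .comp _ _ hg hf
  | tensor f g _ _ hf hg => rw [P.dagger_tensor]; exact .tensor _ _ hf hg

/-- The sub-prop of `P` generated by a family of morphisms that is closed under the dagger, with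
the operations of `P`. -/
def DaggerProp.sub (P : DaggerProp.{u}) (S : ∀ m n, P.toDaggerPropData.Hom m n → Prop)
    (hS : ∀ m n f, S m n f → S n m (P.dagger f)) : DaggerProp.{u} :=
  DaggerPropData.ofEmbedding
    { Hom := fun m n => {f : P.toDaggerPropData.Hom m n // P.Generated S m n f}
      id := fun n => ⟨P.id n, .id n⟩
      comp := fun f g => ⟨P.comp f.1 g.1, .comp _ _ f.2 g.2⟩
      tensor := fun f g => ⟨P.tensor f.1 g.1, .tensor _ _ f.2 g.2⟩
      braid := fun m n => ⟨P.braid m n, .braid m n⟩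
      dagger := fun f => ⟨P.dagger f.1, f.2.dagger hS⟩ }
    P (fun f => f.1) Subtype.ext (fun _ => rfl) (fun _ _ => rfl) (fun _ _ => rfl)
    (fun _ _ => rfl) (fun _ => rfl)

/-! ### The dagger prop of relations between powers of a set -/

section Relations

variable (A : Type v)

/-- Relations from `A ^ m` to `A ^ n`, with relational composition and with the cartesian product
of relations as tensor product. -/
def relData : DaggerPropData.{v} where
  Hom m n := (Fin m → A) → (Fin n → A) → Prop
  id _ x y := x = y
  comp R S x z := ∃ y, R x y ∧ S y z
  tensor {m n p q} R S x y :=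
    R (fun i => x (Fin.castAdd p i)) (fun i => y (Fin.castAdd q i)) ∧
      S (fun i => x (Fin.natAdd m i)) (fun i => y (Fin.natAdd n i))
  braid m n x y := (∀ i, x (Fin.castAdd n i) = y (Fin.natAdd n i)) ∧
    ∀ i, x (Fin.natAdd m i) = y (Fin.castAdd m i)
  dagger R y x := R x y

variable {A}

theorem relData_cast {m n m' n' : ℕ} (h : m = m') (h' : n = n') (R : (relData A).Hom m n) :
    (relData A).cast h h' R = fun x y => R (x ∘ Fin.cast h) (y ∘ Fin.cast h') := by
  subst h h'; rfl

theorem split_ext {m n : ℕ} {x y : Fin (m + n) → A}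
    (h : ∀ i, x (Fin.castAdd n i) = y (Fin.castAdd n i))
    (h' : ∀ i, x (Fin.natAdd m i) = y (Fin.natAdd m i)) : x = y :=
  funext fun i => Fin.addCases h h' i

@[simp] theorem cast_natAdd_assoc {m n p : ℕ} (h : m + n + p = m + (n + p)) (i : Fin p) :
    Fin.cast h (Fin.natAdd (m + n) i) = Fin.natAdd m (Fin.natAdd n i) :=
  Fin.ext (by simp [Nat.add_assoc])

@[simp] theorem cast_natAdd_assoc_symm {m n p : ℕ} (h : m + (n + p) = m + n + p) (i : Fin p) :
    Fin.cast h (Fin.natAdd m (Fin.natAdd n i)) = Fin.natAdd (m + n) i :=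
  Fin.ext (by simp [Nat.add_assoc])

@[simp] theorem cast_castAdd_castAdd {m n p : ℕ} (h : m + n + p = m + (n + p)) (i : Fin m) :
    Fin.cast h (Fin.castAdd p (Fin.castAdd n i)) = Fin.castAdd (n + p) i := rfl

@[simp] theorem cast_castAdd_natAdd {m n p : ℕ} (h : m + n + p = m + (n + p)) (i : Fin n) :
    Fin.cast h (Fin.castAdd p (Fin.natAdd m i)) = Fin.natAdd m (Fin.castAdd p i) := rfl

@[simp] theorem cast_castAdd_symm {m n p : ℕ} (h : m + (n + p) = m + n + p) (i : Fin m) :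
    Fin.cast h (Fin.castAdd (n + p) i) = Fin.castAdd p (Fin.castAdd n i) := rfl

@[simp] theorem cast_natAdd_castAdd_symm {m n p : ℕ} (h : m + (n + p) = m + n + p) (i : Fin n) :
    Fin.cast h (Fin.natAdd m (Fin.castAdd p i)) = Fin.castAdd p (Fin.natAdd m i) := rfl

variable (A)

/-- The dagger prop with the operations `relData`. -/
def relProp : DaggerProp.{v} where
  toDaggerPropData := relData A
  id_comp f := by funext x y; simp [relData]
  comp_id f := by funext x y; simp [relData]
  comp_assoc f g h := by
    funext x y
    simp only [relData, eq_iff_iff]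
    constructor
    · rintro ⟨z, ⟨w, h1, h2⟩, h3⟩; exact ⟨w, h1, z, h2, h3⟩
    · rintro ⟨w, h1, z, h2, h3⟩; exact ⟨z, ⟨w, h1, h2⟩, h3⟩
  id_tensor_id m n := by
    funext x y
    simp only [relData, eq_iff_iff]
    constructor
    · rintro ⟨h, h'⟩; exact split_ext (congrFun h) (congrFun h')
    · rintro rfl; exact ⟨rfl, rfl⟩
  interchange f g f' g' := by
    funext x y
    simp only [relData, eq_iff_iff]
    constructor
    · rintro ⟨⟨z, h1, h2⟩, ⟨w, h3, h4⟩⟩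
      exact ⟨Fin.append z w, by simpa using ⟨⟨h1, h3⟩, h2, h4⟩⟩
    · rintro ⟨z, ⟨h1, h2⟩, h3, h4⟩
      exact ⟨⟨_, h1, h3⟩, _, h2, h4⟩
  tensor_assoc {m n p q r s} f g h := by
    rw [relData_cast]
    funext x y
    simp only [relData, eq_iff_iff, and_assoc]
    refine and_congr Iff.rfl (and_congr ?_ ?_)
    · rw [show (fun i => (x ∘ Fin.cast (Nat.add_assoc m p r)) (Fin.castAdd r (Fin.natAdd m i)))
          = fun i => x (Fin.natAdd m (Fin.castAdd r i)) from rfl]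
      exact Iff.rfl
    · have e1 : (fun i => (x ∘ Fin.cast (Nat.add_assoc m p r)) (Fin.natAdd (m + p) i))
          = fun i => x (Fin.natAdd m (Fin.natAdd p i)) := by
        funext i; simp
      have e2 : (fun i => (y ∘ Fin.cast (Nat.add_assoc n q s)) (Fin.natAdd (n + q) i))
          = fun i => y (Fin.natAdd n (Fin.natAdd q i)) := by
        funext i; simp
      rw [e1, e2]
  id_tensor {m n} f := by
    rw [relData_cast]
    funext x y
    simp only [relData, eq_iff_iff]
    have e1 : (fun i => (x ∘ Fin.cast (Nat.zero_add m)) (Fin.natAdd 0 i)) = x := by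
      funext i; exact congrArg x (Fin.ext (by simp))
    have e2 : (fun i => (y ∘ Fin.cast (Nat.zero_add n)) (Fin.natAdd 0 i)) = y := by
      funext i; exact congrArg y (Fin.ext (by simp))
    rw [e1, e2]
    exact and_iff_right (Subsingleton.elim _ _)
  tensor_id_zero f := by
    rw [relData_cast]
    funext x y
    simp only [relData, eq_iff_iff]
    exact and_iff_left (Subsingleton.elim _ _)
  braid_natural {m n p q} f g := by
    funext x y
    simp only [relData, eq_iff_iff]
    constructor
    · rintro ⟨z, ⟨h1, h2⟩, h3, h4⟩
      refine ⟨Fin.append (fun i => x (Fin.natAdd m i)) (fun i => x (Fin.castAdd p i)), ?_, ?_⟩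
      · simp
      · simp only [Fin.append_left, Fin.append_right, ← h3, ← h4]
        exact ⟨h2, h1⟩
    · rintro ⟨z, ⟨h1, h2⟩, h3, h4⟩
      refine ⟨Fin.append (fun i => y (Fin.natAdd q i)) (fun i => y (Fin.castAdd n i)), ?_, ?_⟩
      · simp only [Fin.append_left, Fin.append_right, h1, h2]
        exact ⟨h4, h3⟩
      · simp
  braid_braid m n := by
    funext x y
    simp only [relData, eq_iff_iff]
    constructor
    · rintro ⟨z, ⟨h1, h2⟩, h3, h4⟩
      exact split_ext (fun i => (h1 i).trans (h4 i)) (fun i => (h2 i).trans (h3 i))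
    · rintro rfl
      exact ⟨Fin.append (fun i => x (Fin.natAdd m i)) (fun i => x (Fin.castAdd n i)), by simp⟩
  hexagon m n p := by
    rw [relData_cast, relData_cast]
    funext x y
    simp only [relData, eq_iff_iff, funext_iff, Function.comp_apply, Fin.cast_eq_self,
      cast_natAdd_assoc, cast_natAdd_assoc_symm, cast_castAdd_castAdd,
      cast_castAdd_natAdd, cast_castAdd_symm, cast_natAdd_castAdd_symm]
    constructor
    · rintro ⟨z, ⟨⟨h1, h2⟩, h3⟩, h4, h5, h6⟩
      refine ⟨fun i => ?_, fun i => Fin.addCases (fun j => ?_) (fun j => ?_) i⟩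
      · simpa using (h1 i).trans (h5 i)
      · simpa using (h2 j).trans (h4 j)
      · simpa using (h3 j).trans (h6 j)
    · rintro ⟨h1, h2⟩
      refine ⟨Fin.append (Fin.append (fun i => x (Fin.natAdd m (Fin.castAdd p i)))
        (fun i => x (Fin.castAdd (n + p) i))) (fun i => x (Fin.natAdd m (Fin.natAdd n i))), ?_⟩
      have h3 := fun i => h2 (Fin.castAdd p i)
      have h4 := fun i => h2 (Fin.natAdd n i)
      simp only [Fin.append_left, Fin.append_right] at h1 h3 h4 ⊢
      exact ⟨⟨⟨fun _ => trivial, fun _ => trivial⟩, fun _ => trivial⟩, h3, h1, h4⟩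
  hexagon' m n p := by
    rw [relData_cast, relData_cast]
    funext x y
    simp only [relData, eq_iff_iff, funext_iff, Function.comp_apply, Fin.cast_eq_self,
      cast_natAdd_assoc, cast_natAdd_assoc_symm, cast_castAdd_castAdd,
      cast_castAdd_natAdd, cast_castAdd_symm, cast_natAdd_castAdd_symm]
    constructor
    · rintro ⟨z, ⟨h1, h2, h3⟩, ⟨h4, h5⟩, h6⟩
      refine ⟨fun i => ?_, fun i => ?_⟩
      · induction i using Fin.addCases with
        | left j => simpa using (h1 j).trans (h4 j)
        | right j => simpa using (h2 j).trans (h6 j)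
      · simpa using (h3 i).trans (h5 i)
    · rintro ⟨h1, h2⟩
      refine ⟨Fin.append (fun i => x (Fin.castAdd p (Fin.castAdd n i)))
        (Fin.append (fun i => x (Fin.natAdd (m + n) i))
          (fun i => x (Fin.castAdd p (Fin.natAdd m i)))), ?_⟩
      have h3 := fun i => h1 (Fin.castAdd n i)
      have h4 := fun i => h1 (Fin.natAdd m i)
      simp only [Fin.append_left, Fin.append_right] at h2 h3 h4 ⊢
      exact ⟨⟨fun _ => trivial, fun _ => trivial, fun _ => trivial⟩, ⟨h3, h2⟩, h4⟩
  dagger_id n := by funext x y; exact propext eq_comm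
  dagger_comp f g := by funext x y; simp only [relData, and_comm]
  dagger_dagger f := rfl
  dagger_tensor f g := rfl
  dagger_braid m n := by
    funext x y
    simp only [relData, eq_iff_iff]
    constructor
    · rintro ⟨h, h'⟩; exact ⟨fun i => (h' i).symm, fun i => (h i).symm⟩
    · rintro ⟨h, h'⟩; exact ⟨fun i => (h' i).symm, fun i => (h i).symm⟩

end Relations

/-! ### Corelations -/

/-- The operations of the dagger prop of corelations: a morphism from `m` to `n` is a partition of
the disjoint union of an `m`-element set and an `n`-element set. -/
def finCorelData : DaggerPropData.{0} where
  Hom m n := Setoid (Fin m ⊕ Fin n)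
  /- The parts of the identity are the pairs consisting of an input and the same output. -/
  id n := Setoid.ker (Sum.elim _root_.id _root_.id : Fin n ⊕ Fin n → Fin n)
  /- Glue the two partitions along the middle set, to the finest common coarsening on the union of
  all three sets, and restrict to the outer sets. -/
  comp {m n p} R S :=
    Setoid.comap (Sum.map _root_.id Sum.inr : Fin m ⊕ Fin p → Fin m ⊕ (Fin n ⊕ Fin p))
      (Setoid.map R (Sum.map _root_.id Sum.inl) ⊔ Setoid.map S Sum.inr)
  /- Disjoint union of partitions. -/
  tensor {m n p q} R S :=
    Setoid.map R (Sum.map (Fin.castAdd p) (Fin.castAdd q)) ⊔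
      Setoid.map S (Sum.map (Fin.natAdd m) (Fin.natAdd n))
  /- The parts are the pairs consisting of an input and its image under the block swap. -/
  braid m n :=
    Setoid.ker (Sum.elim finAddFlip _root_.id : Fin (m + n) ⊕ Fin (n + m) → Fin (n + m))
  dagger R := Setoid.comap Sum.swap R

section Invariants

variable {α β : Type}

theorem setoid_map_le_ker {γ : Type*} {r : Setoid α} {f : α → β} {g : β → γ} :
    Setoid.map r f ≤ Setoid.ker g ↔ r ≤ Setoid.ker (g ∘ f) := by
  constructor
  · intro h a b hab
    exact h (Setoid.le_comap_map hab)
  · intro h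
    refine Setoid.eqvGen_le ?_
    rintro _ _ ⟨a, b, hab, rfl, rfl⟩
    exact h hab

end Invariants

/-- The predicates that are constant on the parts of a corelation, as a relation. -/
def finCorelInv {m n : ℕ} (R : Setoid (Fin m ⊕ Fin n)) : (relData Prop).Hom m n :=
  fun x y => R ≤ Setoid.ker (Sum.elim x y)

theorem finCorelInv_injective {m n : ℕ} {R S : Setoid (Fin m ⊕ Fin n)}
    (h : finCorelInv R = finCorelInv S) : R = S := by
  have key : ∀ {R S : Setoid (Fin m ⊕ Fin n)}, finCorelInv R = finCorelInv S → R ≤ S := by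
    intro R S h a b hab
    have h1 : finCorelInv S (fun i => S a (Sum.inl i)) (fun j => S a (Sum.inr j)) := by
      intro c d hcd
      have e : (Sum.elim (fun i => S a (Sum.inl i)) (fun j => S a (Sum.inr j))
        : Fin m ⊕ Fin n → Prop) = fun c => S a c := by
        funext c; cases c <;> rfl
      rw [Setoid.ker_def, e]
      exact propext ⟨fun h => S.trans' h hcd, fun h => S.trans' h (S.symm' hcd)⟩
    rw [← h] at h1
    have e : (Sum.elim (fun i => S a (Sum.inl i)) (fun j => S a (Sum.inr j))
        : Fin m ⊕ Fin n → Prop) = fun c => S a c := by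
      funext c; cases c <;> rfl
    have h2 := h1 hab
    rw [Setoid.ker_def, e] at h2
    exact (iff_of_eq h2).1 (S.refl' a)
  exact le_antisymm (key h) (key h.symm)

theorem finCorelInv_comp {m n p : ℕ} (R : Setoid (Fin m ⊕ Fin n)) (S : Setoid (Fin n ⊕ Fin p)) :
    finCorelInv (finCorelData.comp R S)
      = (relData Prop).comp (finCorelInv R) (finCorelInv S) := by
  funext x z
  refine propext ⟨fun h => ?_, ?_⟩
  · let T : Setoid (Fin m ⊕ (Fin n ⊕ Fin p)) :=
      Setoid.map R (Sum.map _root_.id Sum.inl) ⊔ Setoid.map S Sum.inr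
    let j : Fin m ⊕ Fin p → Fin m ⊕ (Fin n ⊕ Fin p) := Sum.map _root_.id Sum.inr
    let w : Fin m ⊕ (Fin n ⊕ Fin p) → Prop := fun a => ∃ c, T a (j c) ∧ Sum.elim x z c
    have hw : T ≤ Setoid.ker w := by
      intro a b hab
      exact propext ⟨fun ⟨c, h1, h2⟩ => ⟨c, T.trans' (T.symm' hab) h1, h2⟩,
        fun ⟨c, h1, h2⟩ => ⟨c, T.trans' hab h1, h2⟩⟩
    have hj : ∀ c, w (j c) = Sum.elim x z c := by
      intro c
      refine propext ⟨?_, fun h => ⟨c, T.refl' _, h⟩⟩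
      rintro ⟨d, h1, h2⟩
      have h3 : Sum.elim x z c = Sum.elim x z d := h h1
      rwa [h3]
    have hT := sup_le_iff.1 hw
    refine ⟨fun i => w (Sum.inr (Sum.inl i)), ?_, ?_⟩
    · have := setoid_map_le_ker.1 hT.1
      refine this.trans_eq (congrArg Setoid.ker ?_)
      funext a
      rcases a with a | a
      · exact hj (Sum.inl a)
      · rfl
    · have := setoid_map_le_ker.1 hT.2
      refine this.trans_eq (congrArg Setoid.ker ?_)
      funext a
      rcases a with a | a
      · rfl
      · exact hj (Sum.inr a)
  · rintro ⟨y, h1, h2⟩ a b hab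
    have hT : Setoid.map R (Sum.map _root_.id Sum.inl) ⊔ Setoid.map S Sum.inr
        ≤ Setoid.ker (Sum.elim x (Sum.elim y z)) := by
      refine sup_le (setoid_map_le_ker.2 ?_) (setoid_map_le_ker.2 ?_)
      · refine (show R ≤ _ from h1).trans_eq (congrArg Setoid.ker ?_)
        funext a; cases a <;> rfl
      · exact h2
    have := hT hab
    rw [Setoid.ker_def] at this ⊢
    rcases a with a | a <;> rcases b with b | b <;> exact this

theorem finCorelInv_ker {m n k : ℕ} (f : Fin m → Fin k) (x : Fin m → Prop) (y : Fin n → Prop)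
    (e : Fin k ≃ Fin n) :
    finCorelInv (Setoid.ker (Sum.elim f e.symm)) x y ↔ ∀ i, x i = y (e (f i)) := by
  constructor
  · intro h i
    exact h (x := Sum.inl i) (y := Sum.inr (e (f i))) (by simp [Setoid.ker_def])
  · intro h a b hab
    rw [Setoid.ker_def] at hab ⊢
    have key : ∀ c, Sum.elim x y c = y (e (Sum.elim f e.symm c)) := by
      rintro (c | c)
      · exact h c
      · simp
    rw [key, key, hab]

/-- The dagger prop of corelations. -/
def FinCorel : DaggerProp.{0} :=
  finCorelData.ofEmbedding (relProp Prop) finCorelInv finCorelInv_injective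
    (by
      intro n
      funext x y
      exact propext ((finCorelInv_ker _root_.id x y (Equiv.refl _)).trans funext_iff.symm))
    finCorelInv_comp
    (by
      intro m n p q R S
      funext x y
      refine propext (sup_le_iff.trans (and_congr ?_ ?_))
      · refine setoid_map_le_ker.trans ?_
        rw [Sum.elim_comp_map]; exact Iff.rfl
      · refine setoid_map_le_ker.trans ?_
        rw [Sum.elim_comp_map]; exact Iff.rfl)
    (by
      intro m n
      funext x y
      refine propext ((finCorelInv_ker finAddFlip x y (Equiv.refl _)).trans ?_)
      constructor
      · intro h
        exact ⟨fun i => by simpa using h (Fin.castAdd n i),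
          fun i => by simpa using h (Fin.natAdd m i)⟩
      · rintro ⟨h1, h2⟩ i
        induction i using Fin.addCases with
        | left i => simpa using h1 i
        | right i => simpa using h2 i)
    (by
      intro m n (R : Setoid (Fin m ⊕ Fin n))
      funext y x
      refine propext ⟨fun h a b hab => ?_, fun h a b hab => ?_⟩
      · have := h (x := a.swap) (y := b.swap)
          (by change R a.swap.swap b.swap.swap; simpa using hab)
        rw [Setoid.ker_def] at this ⊢
        rcases a with a | a <;> rcases b with b | b <;> exact this
      · have := h (x := a.swap) (y := b.swap) hab
        rw [Setoid.ker_def] at this ⊢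
        rcases a with a | a <;> rcases b with b | b <;> exact this)

/-! ### Lagrangian relations -/

section Lagrangian

variable {k : Type u} [Field k]

/-- A subspace on which a bilinear form vanishes. -/
def IsIsotropic {V : Type*} [AddCommGroup V] [Module k V] (ω : LinearMap.BilinForm k V)
    (L : Submodule k V) : Prop :=
  ∀ v ∈ L, ∀ w ∈ L, ω v w = 0

/-- An isotropic subspace that is not properly contained in any other isotropic subspace. -/
def IsLagrangian {V : Type*} [AddCommGroup V] [Module k V] (ω : LinearMap.BilinForm k V)
    (L : Submodule k V) : Prop :=
  IsIsotropic ω L ∧ ∀ L' : Submodule k V, IsIsotropic ω L' → L ≤ L' → L' = L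

variable (k)

/-- The symplectic structure on `(k ⊕ k) ^ n`: the direct sum of `n` copies of the form
`ω (φ, I) (φ', I') = φ * I' - φ' * I` on `k ⊕ k`. -/
def symplecticForm (n : ℕ) : LinearMap.BilinForm k (Fin n → k × k) :=
  LinearMap.mk₂ k (fun x y => ∑ i, ((x i).1 * (y i).2 - (y i).1 * (x i).2))
    (fun x x' y => by
      rw [← Finset.sum_add_distrib]; exact Finset.sum_congr rfl fun i _ => by simp; ring)
    (fun c x y => by
      rw [smul_eq_mul, Finset.mul_sum]; exact Finset.sum_congr rfl fun i _ => by simp; ring)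
    (fun x y y' => by
      rw [← Finset.sum_add_distrib]; exact Finset.sum_congr rfl fun i _ => by simp; ring)
    (fun c x y => by
      rw [smul_eq_mul, Finset.mul_sum]; exact Finset.sum_congr rfl fun i _ => by simp; ring)

/-- The symplectic structure on the direct sum of the conjugate of `(k ⊕ k) ^ m` and
`(k ⊕ k) ^ n`. -/
def relationForm (m n : ℕ) : LinearMap.BilinForm k ((Fin m → k × k) × (Fin n → k × k)) :=
  LinearMap.mk₂ k (fun x y => -symplecticForm k m x.1 y.1 + symplecticForm k n x.2 y.2)
    (fun x x' y => by simp; ring) (fun c x y => by simp; ring)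
    (fun x y y' => by simp; ring) (fun c x y => by simp; ring)

/-- Linear Lagrangian relations from `(k ⊕ k) ^ m` to `(k ⊕ k) ^ n`. -/
def LagHom (m n : ℕ) : Type u :=
  {L : Submodule k ((Fin m → k × k) × (Fin n → k × k)) // IsLagrangian (relationForm k m n) L}

variable {k}

theorem isLagrangian_iff {V : Type*} [AddCommGroup V] [Module k V]
    {ω : LinearMap.BilinForm k V} (hω : ω.IsAlt) {L : Submodule k V} :
    IsLagrangian ω L ↔ ∀ v, v ∈ L ↔ ∀ w ∈ L, ω w v = 0 := by
  constructor
  · rintro ⟨h1, h2⟩ v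
    refine ⟨fun hv w hw => h1 w hw v hv, fun h => ?_⟩
    have h3 : L ⊔ k ∙ v = L := by
      refine h2 _ ?_ le_sup_left
      intro a ha b hb
      obtain ⟨a1, ha1, a2, ha2, rfl⟩ := Submodule.mem_sup.1 ha
      obtain ⟨b1, hb1, b2, hb2, rfl⟩ := Submodule.mem_sup.1 hb
      obtain ⟨c, rfl⟩ := Submodule.mem_span_singleton.1 ha2
      obtain ⟨d, rfl⟩ := Submodule.mem_span_singleton.1 hb2
      have h4 : ω v b1 = 0 := by rw [← hω.neg_eq, h b1 hb1, neg_zero]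
      have h5 : ω v v = 0 := hω v
      simp [h1 a1 ha1 b1 hb1, h a1 ha1, h4, h5]
    rw [← h3]
    exact Submodule.mem_sup_right (Submodule.mem_span_singleton_self v)
  · intro h
    refine ⟨fun v hv w hw => (h w).1 hw v hv, fun L' h' hL => le_antisymm ?_ hL⟩
    intro v hv
    exact (h v).2 fun w hw => h' w (hL hw) v hv

theorem symplecticForm_apply {n : ℕ} (x y : Fin n → k × k) :
    symplecticForm k n x y = ∑ i, ((x i).1 * (y i).2 - (y i).1 * (x i).2) := rfl

theorem relationForm_apply {m n : ℕ} (x y : (Fin m → k × k) × (Fin n → k × k)) :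
    relationForm k m n x y = -symplecticForm k m x.1 y.1 + symplecticForm k n x.2 y.2 := rfl

theorem symplecticForm_isAlt (n : ℕ) : (symplecticForm k n).IsAlt := fun x => by
  simp [symplecticForm_apply]

theorem relationForm_isAlt (m n : ℕ) : (relationForm k m n).IsAlt := fun x => by
  rw [relationForm_apply, symplecticForm_isAlt m x.1, symplecticForm_isAlt n x.2]; simp

theorem symplecticForm_single_right {n : ℕ} (x : Fin n → k × k) (i : Fin n) (a : k × k) :
    symplecticForm k n x (Pi.single i a) = (x i).1 * a.2 - a.1 * (x i).2 := by
  rw [symplecticForm_apply, Finset.sum_eq_single i]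
  · simp
  · intro j _ hj; simp [Pi.single_eq_of_ne hj]
  · simp

theorem symplecticForm_separating {n : ℕ} {x : Fin n → k × k}
    (h : ∀ y, symplecticForm k n x y = 0) : x = 0 := by
  funext i
  have h1 := h (Pi.single i (0, 1))
  have h2 := h (Pi.single i (1, 0))
  rw [symplecticForm_single_right] at h1 h2
  exact Prod.ext (by simpa using h1) (by simpa using h2)

theorem mem_lag {m n : ℕ} {L : Submodule k ((Fin m → k × k) × (Fin n → k × k))}
    (hL : IsLagrangian (relationForm k m n) L) {x : Fin m → k × k} {y : Fin n → k × k} :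
    (x, y) ∈ L ↔ ∀ x' y', (x', y') ∈ L → symplecticForm k m x' x = symplecticForm k n y' y := by
  rw [(isLagrangian_iff (relationForm_isAlt m n)).1 hL]
  simp only [Prod.forall, relationForm_apply, neg_add_eq_zero]

theorem isLagrangian_of {m n : ℕ} {L : Submodule k ((Fin m → k × k) × (Fin n → k × k))}
    (h : ∀ x y x' y', (x, y) ∈ L → (x', y') ∈ L →
      symplecticForm k m x' x = symplecticForm k n y' y)
    (h' : ∀ x y, (∀ x' y', (x', y') ∈ L →
      symplecticForm k m x' x = symplecticForm k n y' y) → (x, y) ∈ L) :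
    IsLagrangian (relationForm k m n) L := by
  rw [isLagrangian_iff (relationForm_isAlt m n)]
  simp only [Prod.forall, relationForm_apply, neg_add_eq_zero]
  exact fun x y => ⟨fun hx x' y' hx' => h x y x' y' hx hx', h' x y⟩

/-- The composite of two linear relations. -/
def linComp {U V W : Type*} [AddCommGroup U] [Module k U] [AddCommGroup V] [Module k V]
    [AddCommGroup W] [Module k W] (L : Submodule k (U × V)) (L' : Submodule k (V × W)) :
    Submodule k (U × W) where
  carrier := {x | ∃ v, (x.1, v) ∈ L ∧ (v, x.2) ∈ L'}
  zero_mem' := ⟨0, L.zero_mem, L'.zero_mem⟩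
  add_mem' := by
    rintro a b ⟨v, h1, h2⟩ ⟨w, h3, h4⟩
    exact ⟨v + w, L.add_mem h1 h3, L'.add_mem h2 h4⟩
  smul_mem' := by
    rintro c a ⟨v, h1, h2⟩
    exact ⟨c • v, L.smul_mem c h1, L'.smul_mem c h2⟩

/-- The orthogonal direct sum of two bilinear forms. -/
def prodForm {V W : Type*} [AddCommGroup V] [Module k V] [AddCommGroup W] [Module k W]
    (ω : LinearMap.BilinForm k V) (ω' : LinearMap.BilinForm k W) :
    LinearMap.BilinForm k (V × W) :=
  LinearMap.mk₂ k (fun a b => ω a.1 b.1 + ω' a.2 b.2)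
    (fun x x' y => by simp; ring) (fun c x y => by simp; ring)
    (fun x y y' => by simp; ring) (fun c x y => by simp; ring)

theorem isLagrangian_linComp {m n p : ℕ} {L : Submodule k ((Fin m → k × k) × (Fin n → k × k))}
    {L' : Submodule k ((Fin n → k × k) × (Fin p → k × k))}
    (hL : IsLagrangian (relationForm k m n) L) (hL' : IsLagrangian (relationForm k n p) L') :
    IsLagrangian (relationForm k m p) (linComp L L') := by
  refine isLagrangian_of ?_ ?_
  · rintro x z x' z' ⟨y, h1, h2⟩ ⟨y', h3, h4⟩
    exact ((mem_lag hL).1 h1 _ _ h3).trans ((mem_lag hL').1 h2 _ _ h4)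
  · intro x z h
    let T := ((Fin m → k × k) × (Fin n → k × k)) × ((Fin n → k × k) × (Fin p → k × k))
    let B : LinearMap.BilinForm k T := prodForm (relationForm k m n) (relationForm k n p)
    have hB : ∀ a b : T, B a b = relationForm k m n a.1 b.1 + relationForm k n p a.2 b.2 :=
      fun _ _ => rfl
    have hBalt : B.IsAlt := fun a => by
      rw [hB, relationForm_isAlt m n a.1, relationForm_isAlt n p a.2, add_zero]
    have hBsep : ∀ a : T, (∀ b, B a b = 0) → a = 0 := by
      rintro ⟨⟨a1, a2⟩, a3, a4⟩ h
      have e1 : a1 = 0 := symplecticForm_separating fun y => by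
        simpa [hB, relationForm_apply] using h ((y, 0), (0, 0))
      have e2 : a2 = 0 := symplecticForm_separating fun y => by
        simpa [hB, relationForm_apply] using h ((0, y), (0, 0))
      have e3 : a3 = 0 := symplecticForm_separating fun y => by
        simpa [hB, relationForm_apply] using h ((0, 0), (y, 0))
      have e4 : a4 = 0 := symplecticForm_separating fun y => by
        simpa [hB, relationForm_apply] using h ((0, 0), (0, y))
      rw [e1, e2, e3, e4]; rfl
    have hBnd : B.Nondegenerate :=
      (LinearMap.IsRefl.nondegenerate_iff_separatingLeft hBalt.isRefl).2 hBsep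
    let D : Submodule k T := LinearMap.range
      ((LinearMap.inr k (Fin m → k × k) (Fin n → k × k)).prod
        (LinearMap.inl k (Fin n → k × k) (Fin p → k × k)))
    let K : Submodule k T := L.prod L'
    have h1 : (((x, 0), (0, z)) : T) ∈ B.orthogonal (B.orthogonal (K ⊔ D)) := by
      rw [LinearMap.BilinForm.mem_orthogonal_iff]
      rintro ⟨⟨a, b⟩, b', c⟩ habc
      rw [LinearMap.BilinForm.mem_orthogonal_iff] at habc
      have hK : ∀ t ∈ K, B t ((a, b), (b', c)) = 0 := fun t ht =>
        habc t (Submodule.mem_sup_left ht)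
      have hD : ∀ t ∈ D, B t ((a, b), (b', c)) = 0 := fun t ht =>
        habc t (Submodule.mem_sup_right ht)
      have hbb : b = b' := by
        rw [← sub_eq_zero]
        refine symplecticForm_separating fun y => ?_
        have := hD ((0, y), (y, 0)) ⟨y, rfl⟩
        simp only [hB, relationForm_apply] at this
        rw [← (symplecticForm_isAlt (k := k) n).neg_eq, map_sub, neg_eq_zero]
        simpa [sub_eq_add_neg] using this
      subst hbb
      have ha : (a, b) ∈ L := (mem_lag hL).2 fun x' y' hx' => by
        have := hK ((x', y'), 0) ⟨hx', L'.zero_mem⟩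
        simpa [hB, relationForm_apply, neg_add_eq_zero] using this
      have hc : (b, c) ∈ L' := (mem_lag hL').2 fun x' y' hx' => by
        have := hK (0, (x', y')) ⟨L.zero_mem, hx'⟩
        simpa [hB, relationForm_apply, neg_add_eq_zero] using this
      have := h a c ⟨b, ha, hc⟩
      change B ((a, b), (b, c)) ((x, 0), (0, z)) = 0
      simp [hB, relationForm_apply, this]
    rw [LinearMap.BilinForm.orthogonal_orthogonal hBnd hBalt.isRefl] at h1
    obtain ⟨⟨⟨a, b⟩, b', c⟩, ⟨h2, h3⟩, _, ⟨d, rfl⟩, h4⟩ := Submodule.mem_sup.1 h1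
    have e1 : a + 0 = x := congrArg (fun t => t.1.1) h4
    have e2 : b + d = 0 := congrArg (fun t => t.1.2) h4
    have e3 : b' + d = 0 := congrArg (fun t => t.2.1) h4
    have e4 : c + 0 = z := congrArg (fun t => t.2.2) h4
    rw [add_zero] at e1 e4
    subst e1 e4
    have h7 : b = b' := add_right_cancel (e2.trans e3.symm)
    subst h7
    exact ⟨b, h2, h3⟩

end Lagrangian

section LagrangianProp

variable (k : Type u) [Field k]

theorem symplecticForm_add {m n : ℕ} (x y : Fin (m + n) → k × k) :
    symplecticForm k (m + n) x y
      = symplecticForm k m (fun i => x (Fin.castAdd n i)) (fun i => y (Fin.castAdd n i))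
        + symplecticForm k n (fun i => x (Fin.natAdd m i)) (fun i => y (Fin.natAdd m i)) := by
  simp only [symplecticForm_apply, Fin.sum_univ_add]

/-- The diagonal subspace. -/
def linId (V : Type*) [AddCommGroup V] [Module k V] : Submodule k (V × V) where
  carrier := {x | x.1 = x.2}
  zero_mem' := rfl
  add_mem' := by rintro a b (h : _ = _) (h' : _ = _); change _ + _ = _ + _; rw [h, h']
  smul_mem' := by rintro c a (h : _ = _); change _ • _ = _ • _; rw [h]

variable {k}

/-- The dagger of a linear relation: the opposite relation. -/
def linDagger {V W : Type*} [AddCommGroup V] [Module k V] [AddCommGroup W] [Module k W]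
    (L : Submodule k (V × W)) : Submodule k (W × V) where
  carrier := {x | (x.2, x.1) ∈ L}
  zero_mem' := L.zero_mem
  add_mem' := fun h h' => L.add_mem h h'
  smul_mem' := fun c _ h => L.smul_mem c h

/-- The direct sum of two linear relations between powers of `V`. -/
def linSum {V : Type*} [AddCommGroup V] [Module k V] {m n p q : ℕ}
    (L : Submodule k ((Fin m → V) × (Fin n → V))) (L' : Submodule k ((Fin p → V) × (Fin q → V))) :
    Submodule k ((Fin (m + p) → V) × (Fin (n + q) → V)) where
  carrier := {x | (fun i => x.1 (Fin.castAdd p i), fun i => x.2 (Fin.castAdd q i)) ∈ L ∧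
    (fun i => x.1 (Fin.natAdd m i), fun i => x.2 (Fin.natAdd n i)) ∈ L'}
  zero_mem' := ⟨L.zero_mem, L'.zero_mem⟩
  add_mem' := fun h h' => ⟨L.add_mem h.1 h'.1, L'.add_mem h.2 h'.2⟩
  smul_mem' := fun c _ h => ⟨L.smul_mem c h.1, L'.smul_mem c h.2⟩

variable (k)

/-- The graph of the block swap of `m` and `n` coordinates. -/
def linBraid (V : Type*) [AddCommGroup V] [Module k V] (m n : ℕ) :
    Submodule k ((Fin (m + n) → V) × (Fin (n + m) → V)) where
  carrier := {x | (∀ i, x.1 (Fin.castAdd n i) = x.2 (Fin.natAdd n i)) ∧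
    ∀ i, x.1 (Fin.natAdd m i) = x.2 (Fin.castAdd m i)}
  zero_mem' := ⟨fun _ => rfl, fun _ => rfl⟩
  add_mem' := fun h h' => ⟨fun i => congrArg₂ (· + ·) (h.1 i) (h'.1 i),
    fun i => congrArg₂ (· + ·) (h.2 i) (h'.2 i)⟩
  smul_mem' := fun c _ h => ⟨fun i => congrArg (c • ·) (h.1 i), fun i => congrArg (c • ·) (h.2 i)⟩

variable {k}

theorem isLagrangian_linDagger {m n : ℕ} {L : Submodule k ((Fin m → k × k) × (Fin n → k × k))}
    (hL : IsLagrangian (relationForm k m n) L) :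
    IsLagrangian (relationForm k n m) (linDagger L) :=
  isLagrangian_of (fun _ _ _ _ h h' => ((mem_lag hL).1 h _ _ h').symm)
    (fun _ _ h => (mem_lag hL).2 fun x' y' h' => (h y' x' h').symm)

theorem isLagrangian_linId (n : ℕ) : IsLagrangian (relationForm k n n) (linId k (Fin n → k × k)) :=
  isLagrangian_of (by rintro x y x' y' (rfl : x = y) (rfl : x' = y'); rfl) (fun x y h => by
    change x = y
    rw [← sub_eq_zero]
    refine symplecticForm_separating fun z => ?_
    rw [← (symplecticForm_isAlt n).neg_eq, map_sub, h z z rfl, sub_self, neg_zero])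

theorem isLagrangian_linSum {m n p q : ℕ} {L : Submodule k ((Fin m → k × k) × (Fin n → k × k))}
    {L' : Submodule k ((Fin p → k × k) × (Fin q → k × k))}
    (hL : IsLagrangian (relationForm k m n) L) (hL' : IsLagrangian (relationForm k p q) L') :
    IsLagrangian (relationForm k (m + p) (n + q)) (linSum L L') := by
  refine isLagrangian_of ?_ ?_
  · intro x y x' y' h h'
    rw [symplecticForm_add, symplecticForm_add]
    exact congrArg₂ (· + ·) ((mem_lag hL).1 h.1 _ _ h'.1) ((mem_lag hL').1 h.2 _ _ h'.2)
  · intro x y h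
    constructor
    · refine (mem_lag hL).2 fun x' y' h' => ?_
      have := h (Fin.append x' 0) (Fin.append y' 0) ⟨by simpa using h', by
        simp only [Fin.append_right]; exact L'.zero_mem⟩
      rw [symplecticForm_add, symplecticForm_add] at this
      have e : ∀ n, (fun _ : Fin n => (0 : k × k)) = 0 := fun _ => rfl
      simpa [e] using this
    · refine (mem_lag hL').2 fun x' y' h' => ?_
      have := h (Fin.append 0 x') (Fin.append 0 y') ⟨by
        simp only [Fin.append_left]; exact L.zero_mem, by simpa using h'⟩
      rw [symplecticForm_add, symplecticForm_add] at this
      have e : ∀ n, (fun _ : Fin n => (0 : k × k)) = 0 := fun _ => rfl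
      simpa [e] using this

theorem isLagrangian_linBraid (m n : ℕ) :
    IsLagrangian (relationForm k (m + n) (n + m)) (linBraid k (k × k) m n) := by
  refine isLagrangian_of ?_ ?_
  · intro x y x' y' h h'
    rw [symplecticForm_add, symplecticForm_add]
    have e1 := funext h.1
    have e2 := funext h.2
    have e3 := funext h'.1
    have e4 := funext h'.2
    dsimp only at e1 e2 e3 e4
    rw [e1, e2, e3, e4, add_comm]
  · intro x y h
    have key : ∀ z : Fin (m + n) → k × k, symplecticForm k (m + n) z x
        = symplecticForm k (m + n) z
          (Fin.append (fun i => y (Fin.natAdd n i)) (fun i => y (Fin.castAdd m i))) := by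
      intro z
      rw [h z (Fin.append (fun i => z (Fin.natAdd m i)) (fun i => z (Fin.castAdd n i)))
        ⟨by simp, by simp⟩, symplecticForm_add, symplecticForm_add, add_comm]
      simp
    have e : x = Fin.append (fun i => y (Fin.natAdd n i)) (fun i => y (Fin.castAdd m i)) := by
      rw [← sub_eq_zero]
      refine symplecticForm_separating fun z => ?_
      rw [← (symplecticForm_isAlt _).neg_eq, map_sub, key, sub_self, neg_zero]
    rw [e]
    exact ⟨by simp, by simp⟩

variable (k)

/-- The operations of the dagger prop of linear Lagrangian relations: relational composition,
direct sum, swap and opposite relation. -/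
def lagRelData : DaggerPropData.{u} where
  Hom m n := LagHom k m n
  id n := ⟨linId k (Fin n → k × k), isLagrangian_linId n⟩
  comp L L' := ⟨linComp L.1 L'.1, isLagrangian_linComp L.2 L'.2⟩
  tensor L L' := ⟨linSum L.1 L'.1, isLagrangian_linSum L.2 L'.2⟩
  braid m n := ⟨linBraid k (k × k) m n, isLagrangian_linBraid m n⟩
  dagger L := ⟨linDagger L.1, isLagrangian_linDagger L.2⟩

/-- The dagger prop of linear Lagrangian relations over `k`. -/
def LagRel : DaggerProp.{u} :=
  (lagRelData k).ofEmbedding (relProp (k × k)) (fun L x y => (x, y) ∈ L.1)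
    (fun h => Subtype.ext <| Submodule.ext fun ⟨x, y⟩ =>
      iff_of_eq (congrFun (congrFun h x) y))
    (fun _ => rfl) (fun _ _ => rfl) (fun _ _ => rfl) (fun _ _ => rfl) (fun _ => rfl)

variable {k}

/-! Linear relations between powers of `k`. -/

variable (k)

/-- Addition `+ : k ⊕ k → k`. -/
def addRel : Submodule k ((Fin 2 → k) × (Fin 1 → k)) where
  carrier := {x | x.2 0 = x.1 0 + x.1 1}
  zero_mem' := by simp
  add_mem' := by
    rintro a b (h : _ = _) (h' : _ = _)
    change a.2 0 + b.2 0 = (a.1 0 + b.1 0) + (a.1 1 + b.1 1)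
    rw [h, h', add_add_add_comm]
  smul_mem' := by
    rintro c a (h : _ = _)
    change c * a.2 0 = c * a.1 0 + c * a.1 1
    rw [h, mul_add]

@[simp] theorem mem_addRel {x : Fin 2 → k} {y : Fin 1 → k} :
    (x, y) ∈ addRel k ↔ y 0 = x 0 + x 1 := Iff.rfl

/-- Zero `0 : {0} → k`. -/
def zeroRel : Submodule k ((Fin 0 → k) × (Fin 1 → k)) where
  carrier := {x | x.2 0 = 0}
  zero_mem' := rfl
  add_mem' := by
    rintro a b (h : _ = _) (h' : _ = _)
    change a.2 0 + b.2 0 = 0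
    rw [h, h', add_zero]
  smul_mem' := by
    rintro c a (h : _ = _)
    change c * a.2 0 = 0
    rw [h, mul_zero]

/-- Duplication `Δ : k → k ⊕ k`. -/
def dupRel : Submodule k ((Fin 1 → k) × (Fin 2 → k)) where
  carrier := {x | x.2 0 = x.1 0 ∧ x.2 1 = x.1 0}
  zero_mem' := ⟨rfl, rfl⟩
  add_mem' := fun h h' => ⟨congrArg₂ (· + ·) h.1 h'.1, congrArg₂ (· + ·) h.2 h'.2⟩
  smul_mem' := fun c _ h => ⟨congrArg (c * ·) h.1, congrArg (c * ·) h.2⟩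

/-- Deletion `! : k → {0}`. -/
def delRel : Submodule k ((Fin 1 → k) × (Fin 0 → k)) := ⊤

variable {k}

/-- The direct sum `R ⊕ S` of a linear relation `R` between efforts and a linear relation `S`
between flows, as a linear relation between tuples of pairs (effort, flow). -/
def effortFlow {m n : ℕ} (R S : Submodule k ((Fin m → k) × (Fin n → k))) :
    Submodule k ((Fin m → k × k) × (Fin n → k × k)) where
  carrier := {x | (fun i => (x.1 i).1, fun j => (x.2 j).1) ∈ R ∧
    (fun i => (x.1 i).2, fun j => (x.2 j).2) ∈ S}
  zero_mem' := ⟨R.zero_mem, S.zero_mem⟩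
  add_mem' := fun h h' => ⟨R.add_mem h.1 h'.1, S.add_mem h.2 h'.2⟩
  smul_mem' := fun c _ h => ⟨R.smul_mem c h.1, S.smul_mem c h.2⟩

variable (k)

theorem isLagrangian_add_dup :
    IsLagrangian (relationForm k 2 1) (effortFlow (addRel k) (linDagger (dupRel k))) := by
  refine isLagrangian_of ?_ ?_
  · rintro x y x' y' ⟨h1 : _ = _, h2 : _ = _, h3 : _ = _⟩ ⟨h4 : _ = _, h5 : _ = _, h6 : _ = _⟩
    dsimp only at h1 h2 h3 h4 h5 h6
    simp only [symplecticForm_apply, Fin.sum_univ_two, Fin.sum_univ_one, h1, h2, h3, h4, h5, h6]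
    ring
  · intro x y h
    have e1 := h ![(1, 0), (0, 0)] ![(1, 0)] (by
      refine ⟨?_, ?_, ?_⟩ <;> simp)
    have e2 := h ![(0, 0), (1, 0)] ![(1, 0)] (by
      refine ⟨?_, ?_, ?_⟩ <;> simp)
    have e3 := h ![(0, 1), (0, 1)] ![(0, 1)] (by
      refine ⟨?_, ?_, ?_⟩ <;> simp)
    simp [symplecticForm_apply] at e1 e2 e3
    refine ⟨?_, ?_, ?_⟩
    · change (y 0).1 = (x 0).1 + (x 1).1
      linear_combination e3
    · exact e1
    · exact e2

theorem isLagrangian_zero_del :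
    IsLagrangian (relationForm k 0 1) (effortFlow (zeroRel k) (linDagger (delRel k))) := by
  refine isLagrangian_of ?_ ?_
  · rintro x y x' y' ⟨h1 : _ = _, -⟩ ⟨h4 : _ = _, -⟩
    dsimp only at h1 h4
    simp [symplecticForm_apply, h1, h4]
  · intro x y h
    have e1 := h ![] ![(0, 1)] ⟨rfl, trivial⟩
    simp [symplecticForm_apply] at e1
    exact ⟨e1, trivial⟩

theorem isLagrangian_dup_add :
    IsLagrangian (relationForm k 2 1) (effortFlow (linDagger (dupRel k)) (addRel k)) := by
  refine isLagrangian_of ?_ ?_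
  · rintro x y x' y' ⟨⟨h1 : _ = _, h2 : _ = _⟩, h3 : _ = _⟩ ⟨⟨h4 : _ = _, h5 : _ = _⟩, h6 : _ = _⟩
    dsimp only at h1 h2 h3 h4 h5 h6
    simp only [symplecticForm_apply, Fin.sum_univ_two, Fin.sum_univ_one, h1, h2, h3, h4, h5, h6]
    ring
  · intro x y h
    have e1 := h ![(0, 1), (0, 0)] ![(0, 1)] (by
      refine ⟨⟨?_, ?_⟩, ?_⟩ <;> simp)
    have e2 := h ![(0, 0), (0, 1)] ![(0, 1)] (by
      refine ⟨⟨?_, ?_⟩, ?_⟩ <;> simp)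
    have e3 := h ![(1, 0), (1, 0)] ![(1, 0)] (by
      refine ⟨⟨?_, ?_⟩, ?_⟩ <;> simp)
    simp [symplecticForm_apply] at e1 e2 e3
    refine ⟨⟨?_, ?_⟩, ?_⟩
    · exact e1
    · exact e2
    · change (y 0).2 = (x 0).2 + (x 1).2
      linear_combination -e3

theorem isLagrangian_del_zero :
    IsLagrangian (relationForm k 0 1) (effortFlow (linDagger (delRel k)) (zeroRel k)) := by
  refine isLagrangian_of ?_ ?_
  · rintro x y x' y' ⟨-, h1 : _ = _⟩ ⟨-, h4 : _ = _⟩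
    dsimp only at h1 h4
    simp [symplecticForm_apply, h1, h4]
  · intro x y h
    have e1 := h ![] ![(1, 0)] ⟨trivial, rfl⟩
    simp [symplecticForm_apply] at e1
    exact ⟨trivial, e1.symm⟩

/-- The linear Lagrangian relation `+ ⊕ Δ†`. -/
def addDup : LagHom k 2 1 :=
  ⟨effortFlow (addRel k) (linDagger (dupRel k)), isLagrangian_add_dup k⟩

/-- The linear Lagrangian relation `0 ⊕ !†`. -/
def zeroDel : LagHom k 0 1 :=
  ⟨effortFlow (zeroRel k) (linDagger (delRel k)), isLagrangian_zero_del k⟩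

/-- The linear Lagrangian relation `Δ† ⊕ +`. -/
def dupAdd : LagHom k 2 1 :=
  ⟨effortFlow (linDagger (dupRel k)) (addRel k), isLagrangian_dup_add k⟩

/-- The linear Lagrangian relation `!† ⊕ 0`. -/
def delZero : LagHom k 0 1 :=
  ⟨effortFlow (linDagger (delRel k)) (zeroRel k), isLagrangian_del_zero k⟩

/-- The linear Lagrangian relation `+† ⊕ Δ`. -/
def addDup' : LagHom k 1 2 :=
  ⟨effortFlow (linDagger (addRel k)) (dupRel k), isLagrangian_linDagger (isLagrangian_add_dup k)⟩

/-- The linear Lagrangian relation `0† ⊕ !`. -/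
def zeroDel' : LagHom k 1 0 :=
  ⟨effortFlow (linDagger (zeroRel k)) (delRel k), isLagrangian_linDagger (isLagrangian_zero_del k)⟩

/-- The linear Lagrangian relation `Δ ⊕ +†`. -/
def dupAdd' : LagHom k 1 2 :=
  ⟨effortFlow (dupRel k) (linDagger (addRel k)), isLagrangian_linDagger (isLagrangian_dup_add k)⟩

/-- The linear Lagrangian relation `! ⊕ 0†`. -/
def delZero' : LagHom k 1 0 :=
  ⟨effortFlow (delRel k) (linDagger (zeroRel k)), isLagrangian_linDagger (isLagrangian_del_zero k)⟩

/-- The eight generating linear Lagrangian relations. -/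
inductive IsLagGen : ∀ m n, LagHom k m n → Prop
  | addDup : IsLagGen 2 1 (addDup k)
  | zeroDel : IsLagGen 0 1 (zeroDel k)
  | addDup' : IsLagGen 1 2 (addDup' k)
  | zeroDel' : IsLagGen 1 0 (zeroDel' k)
  | dupAdd : IsLagGen 2 1 (dupAdd k)
  | delZero : IsLagGen 0 1 (delZero k)
  | dupAdd' : IsLagGen 1 2 (dupAdd' k)
  | delZero' : IsLagGen 1 0 (delZero' k)

theorem isLagGen_dagger (m n : ℕ) (f : LagHom k m n) (h : IsLagGen k m n f) :
    IsLagGen k n m ((LagRel k).dagger f) := by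
  cases h
  exacts [.addDup', .zeroDel', .addDup, .zeroDel, .dupAdd', .delZero', .dupAdd, .delZero]

/-- The sub-prop of `LagRel k` generated by the eight linear Lagrangian relations `IsLagGen`. -/
def LagRelO : DaggerProp.{u} := (LagRel k).sub (IsLagGen k) (isLagGen_dagger k)

end LagrangianProp

/-! ### Corelations between multiples of 2 -/

/-- The multiplication `m : 2 → 1` of `FinCorel`: the partition with one part. -/
def corM : FinCorel.Hom 2 1 := (⊤ : Setoid (Fin 2 ⊕ Fin 1))

/-- The unit `i : 0 → 1` of `FinCorel`: the partition with one part. -/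
def corI : FinCorel.Hom 0 1 := (⊤ : Setoid (Fin 0 ⊕ Fin 1))

/-- The comultiplication `d : 1 → 2` of `FinCorel`: the partition with one part. -/
def corD : FinCorel.Hom 1 2 := (⊤ : Setoid (Fin 1 ⊕ Fin 2))

/-- The counit `e : 1 → 0` of `FinCorel`: the partition with one part. -/
def corE : FinCorel.Hom 1 0 := (⊤ : Setoid (Fin 1 ⊕ Fin 0))

/-- `m₂ = id₁ + (e ∘ m) + id₁ : 4 → 2`. -/
def corM₂ : FinCorel.Hom 4 2 :=
  FinCorel.tensor (FinCorel.tensor (FinCorel.id 1) (FinCorel.comp corM corE)) (FinCorel.id 1)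

/-- `i₂ = d ∘ i : 0 → 2`. -/
def corI₂ : FinCorel.Hom 0 2 := FinCorel.comp corI corD

/-- `d₂ = id₁ + (d ∘ i) + id₁ : 2 → 4`. -/
def corD₂ : FinCorel.Hom 2 4 :=
  FinCorel.tensor (FinCorel.tensor (FinCorel.id 1) (FinCorel.comp corI corD)) (FinCorel.id 1)

/-- `e₂ = e ∘ m : 2 → 0`. -/
def corE₂ : FinCorel.Hom 2 0 := FinCorel.comp corM corE

/-- The swap of the middle two of four points. -/
def corSwap : FinCorel.Hom 4 4 :=
  FinCorel.tensor (FinCorel.tensor (FinCorel.id 1) (FinCorel.braid 1 1)) (FinCorel.id 1)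

/-- `μ₂ = (m + m) ∘ (id₁ + B₁₁ + id₁) : 4 → 2`. -/
def corMu₂ : FinCorel.Hom 4 2 := FinCorel.comp corSwap (FinCorel.tensor corM corM)

/-- `ι₂ = i + i : 0 → 2`. -/
def corIota₂ : FinCorel.Hom 0 2 := FinCorel.tensor corI corI

/-- `δ₂ = (id₁ + B₁₁ + id₁) ∘ (d + d) : 2 → 4`. -/
def corDelta₂ : FinCorel.Hom 2 4 := FinCorel.comp (FinCorel.tensor corD corD) corSwap

/-- `ε₂ = e + e : 2 → 0`. -/
def corEps₂ : FinCorel.Hom 2 0 := FinCorel.tensor corE corE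

/-- The eight generating corelations between even numbers.  The even number `2 * n` is the object
`n` of `FinCorel.multiples 2`. -/
inductive IsCorelGen : ∀ m n, (FinCorel.multiples 2).Hom m n → Prop
  | m₂ : IsCorelGen 2 1 corM₂
  | i₂ : IsCorelGen 0 1 corI₂
  | d₂ : IsCorelGen 1 2 corD₂
  | e₂ : IsCorelGen 1 0 corE₂
  | μ₂ : IsCorelGen 2 1 corMu₂
  | ι₂ : IsCorelGen 0 1 corIota₂
  | δ₂ : IsCorelGen 1 2 corDelta₂
  | ε₂ : IsCorelGen 1 0 corEps₂

theorem corM_dagger : FinCorel.dagger corM = corD := rfl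
theorem corI_dagger : FinCorel.dagger corI = corE := rfl
theorem corD_dagger : FinCorel.dagger corD = corM := rfl
theorem corE_dagger : FinCorel.dagger corE = corI := rfl

theorem corSwap_dagger : FinCorel.dagger corSwap = corSwap :=
  (FinCorel.dagger_tensor _ _).trans (congrArg₂ FinCorel.tensor
    ((FinCorel.dagger_tensor _ _).trans
      (congrArg₂ FinCorel.tensor (FinCorel.dagger_id 1) (FinCorel.dagger_braid 1 1)))
    (FinCorel.dagger_id 1))

theorem corI₂_dagger : FinCorel.dagger corI₂ = corE₂ := FinCorel.dagger_comp _ _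

theorem corE₂_dagger : FinCorel.dagger corE₂ = corI₂ := FinCorel.dagger_comp _ _

theorem corM₂_dagger : FinCorel.dagger corM₂ = corD₂ :=
  (FinCorel.dagger_tensor _ _).trans (congrArg₂ FinCorel.tensor
    ((FinCorel.dagger_tensor _ _).trans
      (congrArg₂ FinCorel.tensor (FinCorel.dagger_id 1) corE₂_dagger))
    (FinCorel.dagger_id 1))

theorem corD₂_dagger : FinCorel.dagger corD₂ = corM₂ := by
  rw [← corM₂_dagger, FinCorel.dagger_dagger]

theorem corMu₂_dagger : FinCorel.dagger corMu₂ = corDelta₂ :=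
  (FinCorel.dagger_comp _ _).trans
    (congrArg₂ FinCorel.comp (FinCorel.dagger_tensor _ _) corSwap_dagger)

theorem corDelta₂_dagger : FinCorel.dagger corDelta₂ = corMu₂ := by
  rw [← corMu₂_dagger, FinCorel.dagger_dagger]

theorem corIota₂_dagger : FinCorel.dagger corIota₂ = corEps₂ := FinCorel.dagger_tensor _ _

theorem corEps₂_dagger : FinCorel.dagger corEps₂ = corIota₂ := FinCorel.dagger_tensor _ _

theorem isCorelGen_dagger (m n : ℕ) (f : (FinCorel.multiples 2).Hom m n)
    (h : IsCorelGen m n f) : IsCorelGen n m ((FinCorel.multiples 2).dagger f) := by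
  cases h with
  | m₂ => exact (congrArg (IsCorelGen 1 2) corM₂_dagger).mpr .d₂
  | i₂ => exact (congrArg (IsCorelGen 1 0) corI₂_dagger).mpr .e₂
  | d₂ => exact (congrArg (IsCorelGen 2 1) corD₂_dagger).mpr .m₂
  | e₂ => exact (congrArg (IsCorelGen 0 1) corE₂_dagger).mpr .i₂
  | μ₂ => exact (congrArg (IsCorelGen 1 2) corMu₂_dagger).mpr .δ₂
  | ι₂ => exact (congrArg (IsCorelGen 1 0) corIota₂_dagger).mpr .ε₂
  | δ₂ => exact (congrArg (IsCorelGen 2 1) corDelta₂_dagger).mpr .μ₂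
  | ε₂ => exact (congrArg (IsCorelGen 0 1) corEps₂_dagger).mpr .ι₂

/-- The dagger prop of corelations between even numbers generated by the eight corelations
`IsCorelGen`. -/
def FinCorelO : DaggerProp.{0} := (FinCorel.multiples 2).sub IsCorelGen isCorelGen_dagger

/-! ### Bond graphs -/

/-- The eight generators: the multiplication `M`, unit `I`, comultiplication `D` and counit `E`
given by 1-junctions, and those given by 0-junctions, which carry a prime. -/
inductive Junction : ℕ → ℕ → Type
  | M : Junction 2 1
  | I : Junction 0 1
  | D : Junction 1 2
  | E : Junction 1 0
  | M' : Junction 2 1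
  | I' : Junction 0 1
  | D' : Junction 1 2
  | E' : Junction 1 0

/-- The reflection of generators. -/
def Junction.dagger : ∀ {m n}, Junction m n → Junction n m
  | _, _, .M => .D
  | _, _, .I => .E
  | _, _, .D => .M
  | _, _, .E => .I
  | _, _, .M' => .D'
  | _, _, .I' => .E'
  | _, _, .D' => .M'
  | _, _, .E' => .I'

/-- Formal expressions in the generators and the operations of a prop. -/
inductive Term : ℕ → ℕ → Type
  | gen {m n} : Junction m n → Term m n
  | ident (n) : Term n n
  | comp {m n p} : Term m n → Term n p → Term m p
  | tensor {m n p q} : Term m n → Term p q → Term (m + p) (n + q)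
  | braid (m n) : Term (m + n) (n + m)

namespace Term

/-- The reflection of expressions. -/
def dagger : ∀ {m n}, Term m n → Term n m
  | _, _, gen g => gen g.dagger
  | _, _, ident n => ident n
  | _, _, comp f g => comp g.dagger f.dagger
  | _, _, tensor f g => tensor f.dagger g.dagger
  | _, _, braid m n => braid n m

/-- Transport of an expression along equalities between its source, resp. target, objects. -/
def cast {m n m' n' : ℕ} (h : m = m') (h' : n = n') (f : Term m n) : Term m' n' := h ▸ h' ▸ f

theorem cast_cast {m n m' n' m'' n'' : ℕ} (h : m = m') (h' : n = n') (k : m' = m'')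
    (k' : n' = n'') (f : Term m n) :
    cast k k' (cast h h' f) = cast (h.trans k) (h'.trans k') f := by
  subst h h' k k'; rfl

theorem comp_cast_left {m n p m' n' : ℕ} (h : m = m') (h' : n = n') (f : Term m n)
    (g : Term n' p) : (cast h h' f).comp g = cast h rfl (f.comp (cast h'.symm rfl g)) := by
  subst h h'; rfl

theorem dagger_cast {m n m' n' : ℕ} (h : m = m') (h' : n = n') (f : Term m n) :
    (cast h h' f).dagger = cast h' h f.dagger := by
  subst h h'; rfl

end Term

open Term in
/-- The equations of an extraspecial symmetric Frobenius monoid on the object `1` with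
multiplication `μ`, unit `ι`, comultiplication `δ` and counit `ε`.  The equation `cosymmetric`
follows from the others; it is listed so that the equations are invariant under reflection. -/
inductive FrobeniusEq (μ : Term 2 1) (ι : Term 0 1) (δ : Term 1 2) (ε : Term 1 0) :
    ∀ {m n}, Term m n → Term m n → Prop
  | assoc : FrobeniusEq μ ι δ ε ((μ.tensor (ident 1)).comp μ) (((ident 1).tensor μ).comp μ)
  | unit_left : FrobeniusEq μ ι δ ε ((ι.tensor (ident 1)).comp μ) (ident 1)
  | unit_right : FrobeniusEq μ ι δ ε (((ident 1).tensor ι).comp μ) (ident 1)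
  | coassoc : FrobeniusEq μ ι δ ε (δ.comp (δ.tensor (ident 1))) (δ.comp ((ident 1).tensor δ))
  | counit_left : FrobeniusEq μ ι δ ε (δ.comp (ε.tensor (ident 1))) (ident 1)
  | counit_right : FrobeniusEq μ ι δ ε (δ.comp ((ident 1).tensor ε)) (ident 1)
  | frobenius_left :
      FrobeniusEq μ ι δ ε ((δ.tensor (ident 1)).comp ((ident 1).tensor μ)) (μ.comp δ)
  | frobenius_right :
      FrobeniusEq μ ι δ ε (((ident 1).tensor δ).comp (μ.tensor (ident 1))) (μ.comp δ)
  | special : FrobeniusEq μ ι δ ε (δ.comp μ) (ident 1)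
  | extra : FrobeniusEq μ ι δ ε (ι.comp ε) (ident 0)
  | symmetric : FrobeniusEq μ ι δ ε ((braid 1 1).comp (μ.comp ε)) (μ.comp ε)
  | cosymmetric : FrobeniusEq μ ι δ ε ((ι.comp δ).comp (braid 1 1)) (ι.comp δ)

open Term in
/-- The equations between the monoid `μ`, `ι` and the comonoid `δ`, `ε` of a weak bimonoid. -/
inductive WeakBimonoidEq (μ : Term 2 1) (ι : Term 0 1) (δ : Term 1 2) (ε : Term 1 0) :
    ∀ {m n}, Term m n → Term m n → Prop
  | mul_comul : WeakBimonoidEq μ ι δ ε (μ.comp δ)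
      (((δ.tensor δ).comp (((ident 1).tensor (braid 1 1)).tensor (ident 1))).comp (μ.tensor μ))
  | counit : WeakBimonoidEq μ ι δ ε ((μ.tensor (ident 1)).comp (μ.comp ε))
      ((((ident 1).tensor δ).tensor (ident 1)).comp ((μ.comp ε).tensor (μ.comp ε)))
  | counit' : WeakBimonoidEq μ ι δ ε ((μ.tensor (ident 1)).comp (μ.comp ε))
      ((((ident 1).tensor (δ.comp (braid 1 1))).tensor (ident 1)).comp
        ((μ.comp ε).tensor (μ.comp ε)))
  | unit : WeakBimonoidEq μ ι δ ε ((ι.comp δ).comp (δ.tensor (ident 1)))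
      (((ι.comp δ).tensor (ι.comp δ)).comp (((ident 1).tensor μ).tensor (ident 1)))
  | unit' : WeakBimonoidEq μ ι δ ε ((ι.comp δ).comp (δ.tensor (ident 1)))
      (((ι.comp δ).tensor (ι.comp δ)).comp
        (((ident 1).tensor ((braid 1 1).comp μ)).tensor (ident 1)))

namespace Term

/-- The generators as expressions. -/
abbrev M : Term 2 1 := gen .M
abbrev I : Term 0 1 := gen .I
abbrev D : Term 1 2 := gen .D
abbrev E : Term 1 0 := gen .E
abbrev M' : Term 2 1 := gen .M'
abbrev I' : Term 0 1 := gen .I'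
abbrev D' : Term 1 2 := gen .D'
abbrev E' : Term 1 0 := gen .E'

/-- `M' ∘ D ∘ M ∘ D'`. -/
def loop : Term 1 1 := (D'.comp M).comp (D.comp M')

/-- `M ∘ D' ∘ M' ∘ D`. -/
def loop' : Term 1 1 := (D.comp M').comp (D'.comp M)

end Term

open Term in
/-- The defining equations of the prop of bond graphs.  The monoid and comonoid laws of the two
weak bimonoids `M, I, D', E'` and `M', I', D, E` are among the equations of the two Frobenius
monoids. -/
inductive BondEq : ∀ {m n}, Term m n → Term m n → Prop
  | frobenius {m n} (t u : Term m n) : FrobeniusEq M I D E t u → BondEq t u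
  | frobenius' {m n} (t u : Term m n) : FrobeniusEq M' I' D' E' t u → BondEq t u
  | weakBimonoid {m n} (t u : Term m n) : WeakBimonoidEq M I D' E' t u → BondEq t u
  | weakBimonoid' {m n} (t u : Term m n) : WeakBimonoidEq M' I' D E t u → BondEq t u
  | extra : BondEq (I'.comp E) (ident 0)
  | extra' : BondEq (I.comp E') (ident 0)
  | idem : BondEq (loop.comp loop) loop
  | idem' : BondEq (loop'.comp loop') loop'

open Term in
/-- The congruence on expressions generated by the laws of a prop and the equations `BondEq`. -/
inductive BondRel : ∀ {m n}, Term m n → Term m n → Prop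
  | refl {m n} (f : Term m n) : BondRel f f
  | symm {m n} {f g : Term m n} : BondRel f g → BondRel g f
  | trans {m n} {f g h : Term m n} : BondRel f g → BondRel g h → BondRel f h
  | comp {m n p} {f f' : Term m n} {g g' : Term n p} :
      BondRel f f' → BondRel g g' → BondRel (f.comp g) (f'.comp g')
  | tensor {m n p q} {f f' : Term m n} {g g' : Term p q} :
      BondRel f f' → BondRel g g' → BondRel (f.tensor g) (f'.tensor g')
  | id_comp {m n} (f : Term m n) : BondRel ((ident m).comp f) f
  | comp_id {m n} (f : Term m n) : BondRel (f.comp (ident n)) f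
  | comp_assoc {m n p q} (f : Term m n) (g : Term n p) (h : Term p q) :
      BondRel ((f.comp g).comp h) (f.comp (g.comp h))
  | id_tensor_id (m n) : BondRel ((ident m).tensor (ident n)) (ident (m + n))
  | interchange {m n p m' n' p'} (f : Term m n) (g : Term n p) (f' : Term m' n')
      (g' : Term n' p') :
      BondRel ((f.comp g).tensor (f'.comp g')) ((f.tensor f').comp (g.tensor g'))
  | tensor_assoc {m n p q r s} (f : Term m n) (g : Term p q) (h : Term r s) :
      BondRel (Term.cast (Nat.add_assoc m p r) (Nat.add_assoc n q s) ((f.tensor g).tensor h))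
        (f.tensor (g.tensor h))
  | id_tensor {m n} (f : Term m n) :
      BondRel (Term.cast (Nat.zero_add m) (Nat.zero_add n) ((ident 0).tensor f)) f
  | tensor_id_zero {m n} (f : Term m n) :
      BondRel (Term.cast (Nat.add_zero m) (Nat.add_zero n) (f.tensor (ident 0))) f
  | braid_natural {m n p q} (f : Term m n) (g : Term p q) :
      BondRel ((f.tensor g).comp (braid n q)) ((braid m p).comp (g.tensor f))
  | braid_braid (m n) : BondRel ((braid m n).comp (braid n m)) (ident (m + n))
  | hexagon (m n p) :
      BondRel (Term.cast (Nat.add_assoc m n p) (Nat.add_assoc n p m).symm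
        (((braid m n).tensor (ident p)).comp
          (Term.cast (Nat.add_assoc n m p).symm rfl ((ident n).tensor (braid m p)))))
        (braid m (n + p))
  | hexagon' (m n p) :
      BondRel (Term.cast (Nat.add_assoc m n p).symm (Nat.add_assoc p m n)
        (((ident m).tensor (braid n p)).comp
          (Term.cast (Nat.add_assoc m p n) rfl ((braid m p).tensor (ident n)))))
        (braid (m + n) p)
  | eqn {m n} {f g : Term m n} : BondEq f g → BondRel f g

theorem Junction.dagger_dagger {m n : ℕ} (g : Junction m n) : g.dagger.dagger = g := by
  cases g <;> rfl

theorem Term.dagger_dagger {m n : ℕ} (f : Term m n) : f.dagger.dagger = f := by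
  induction f with
  | gen g => simp [dagger, Junction.dagger_dagger]
  | ident n => rfl
  | comp f g hf hg => simp [dagger, hf, hg]
  | tensor f g hf hg => simp [dagger, hf, hg]
  | braid m n => rfl

namespace BondRel

open Term

theorem cast {m n m' n' : ℕ} (h : m = m') (h' : n = n') {f g : Term m n} (r : BondRel f g) :
    BondRel (Term.cast h h' f) (Term.cast h h' g) := by
  subst h h'; exact r

theorem of_eq {m n : ℕ} {f g : Term m n} (h : f = g) : BondRel f g := h ▸ refl f

theorem frobenius_dagger {μ : Term 2 1} {ι : Term 0 1} {δ : Term 1 2} {ε : Term 1 0}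
    (hμ : μ.dagger = δ) (hι : ι.dagger = ε) (hδ : δ.dagger = μ) (hε : ε.dagger = ι)
    (H : ∀ {m n} {t u : Term m n}, FrobeniusEq μ ι δ ε t u → BondRel t u)
    {m n : ℕ} {t u : Term m n} (h : FrobeniusEq μ ι δ ε t u) : BondRel t.dagger u.dagger := by
  cases h <;> simp only [dagger, hμ, hι, hδ, hε]
  · exact H .coassoc
  · exact H .counit_left
  · exact H .counit_right
  · exact H .assoc
  · exact H .unit_left
  · exact H .unit_right
  · exact H .frobenius_right
  · exact H .frobenius_left
  · exact H .special
  · exact H .extra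
  · exact H .cosymmetric
  · exact H .symmetric

theorem weakBimonoid_dagger {μ μ' : Term 2 1} {ι ι' : Term 0 1} {δ δ' : Term 1 2}
    {ε ε' : Term 1 0} (hμ : μ.dagger = δ') (hι : ι.dagger = ε') (hδ : δ.dagger = μ')
    (hε : ε.dagger = ι')
    (H : ∀ {m n} {t u : Term m n}, WeakBimonoidEq μ' ι' δ' ε' t u → BondRel t u)
    {m n : ℕ} {t u : Term m n} (h : WeakBimonoidEq μ ι δ ε t u) :
    BondRel t.dagger u.dagger := by
  cases h <;> simp only [dagger, hμ, hι, hδ, hε]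
  · exact (H .mul_comul).trans (comp_assoc _ _ _)
  · exact H .unit
  · exact H .unit'
  · exact H .counit
  · exact H .counit'

theorem bondEq_dagger {m n : ℕ} {f g : Term m n} (h : BondEq f g) :
    BondRel f.dagger g.dagger := by
  cases h with
  | frobenius _ _ h =>
    exact frobenius_dagger rfl rfl rfl rfl (fun h => eqn (.frobenius _ _ h)) h
  | frobenius' _ _ h =>
    exact frobenius_dagger rfl rfl rfl rfl (fun h => eqn (.frobenius' _ _ h)) h
  | weakBimonoid _ _ h =>
    exact weakBimonoid_dagger (μ' := M') (ι' := I') (δ' := D) (ε' := E) rfl rfl rfl rfl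
      (fun h => eqn (.weakBimonoid' _ _ h)) h
  | weakBimonoid' _ _ h =>
    exact weakBimonoid_dagger (μ' := M) (ι' := I) (δ' := D') (ε' := E') rfl rfl rfl rfl
      (fun h => eqn (.weakBimonoid _ _ h)) h
  | extra => exact eqn .extra'
  | extra' => exact eqn .extra
  | idem => exact eqn .idem
  | idem' => exact eqn .idem'

theorem dagger {m n : ℕ} {f g : Term m n} (h : BondRel f g) : BondRel f.dagger g.dagger := by
  induction h with
  | refl f => exact refl _
  | symm _ h => exact h.symm
  | trans _ _ h h' => exact h.trans h'
  | comp _ _ h h' => exact h'.comp h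
  | tensor _ _ h h' => exact h.tensor h'
  | id_comp f => exact comp_id _
  | comp_id f => exact id_comp _
  | comp_assoc f g h => exact (comp_assoc _ _ _).symm
  | id_tensor_id m n => exact id_tensor_id m n
  | interchange f g f' g' => exact interchange _ _ _ _
  | tensor_assoc f g h =>
    exact (of_eq (Term.dagger_cast _ _ _)).trans (tensor_assoc _ _ _)
  | id_tensor f => exact (of_eq (Term.dagger_cast _ _ _)).trans (id_tensor _)
  | tensor_id_zero f => exact (of_eq (Term.dagger_cast _ _ _)).trans (tensor_id_zero _)
  | braid_natural f g => exact (braid_natural _ _).symm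
  | braid_braid m n => exact braid_braid _ _
  | hexagon m n p =>
    refine (of_eq ?_).trans (hexagon' n p m)
    simp only [Term.dagger_cast, Term.dagger, Term.comp_cast_left, Term.cast_cast]
  | hexagon' m n p =>
    refine (of_eq ?_).trans (hexagon p m n)
    simp only [Term.dagger_cast, Term.dagger, Term.comp_cast_left, Term.cast_cast]
  | eqn h => exact bondEq_dagger h

end BondRel

/-- Expressions up to the congruence `BondRel`. -/
instance bondSetoid (m n : ℕ) : Setoid (Term m n) where
  r := BondRel
  iseqv := ⟨BondRel.refl, BondRel.symm, BondRel.trans⟩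

/-- The operations on bond graphs, induced by those on expressions. -/
def bondGraphData : DaggerPropData.{0} where
  Hom m n := Quotient (bondSetoid m n)
  id n := ⟦Term.ident n⟧
  comp := Quotient.map₂ Term.comp fun _ _ h _ _ h' => BondRel.comp h h'
  tensor := Quotient.map₂ Term.tensor fun _ _ h _ _ h' => BondRel.tensor h h'
  braid m n := ⟦Term.braid m n⟧
  dagger := Quotient.map Term.dagger fun _ _ h => BondRel.dagger h

theorem bondGraphData_cast {m n m' n' : ℕ} (h : m = m') (h' : n = n') (f : Term m n) :
    bondGraphData.cast h h' (⟦f⟧ : Quotient (bondSetoid m n))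
      = (⟦Term.cast h h' f⟧ : Quotient (bondSetoid m' n')) := by
  subst h h'; rfl

/-- The dagger prop of bond graphs: generated by the eight morphisms `Junction`, subject to the
equations `BondEq`, with the dagger determined by `M† = D`, `I† = E`, `M'† = D'`, `I'† = E'`. -/
def BondGraph : DaggerProp.{0} where
  toDaggerPropData := bondGraphData
  id_comp := by rintro m n ⟨f⟩; exact Quotient.sound (BondRel.id_comp f)
  comp_id := by rintro m n ⟨f⟩; exact Quotient.sound (BondRel.comp_id f)
  comp_assoc := by
    rintro m n p q ⟨f⟩ ⟨g⟩ ⟨h⟩; exact Quotient.sound (BondRel.comp_assoc f g h)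
  id_tensor_id m n := Quotient.sound (BondRel.id_tensor_id m n)
  interchange := by
    rintro m n p m' n' p' ⟨f⟩ ⟨g⟩ ⟨f'⟩ ⟨g'⟩; exact Quotient.sound (BondRel.interchange f g f' g')
  tensor_assoc := by
    rintro m n p q r s ⟨f⟩ ⟨g⟩ ⟨h⟩
    exact (bondGraphData_cast _ _ _).trans (Quotient.sound (BondRel.tensor_assoc f g h))
  id_tensor := by
    rintro m n ⟨f⟩
    exact (bondGraphData_cast _ _ _).trans (Quotient.sound (BondRel.id_tensor f))
  tensor_id_zero := by
    rintro m n ⟨f⟩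
    exact (bondGraphData_cast _ _ _).trans (Quotient.sound (BondRel.tensor_id_zero f))
  braid_natural := by
    rintro m n p q ⟨f⟩ ⟨g⟩; exact Quotient.sound (BondRel.braid_natural f g)
  braid_braid m n := Quotient.sound (BondRel.braid_braid m n)
  hexagon m n p := by
    refine (congrArg (fun t => bondGraphData.cast _ _ (bondGraphData.comp _ t))
      (bondGraphData_cast _ _ _)).trans ?_
    exact (bondGraphData_cast _ _ _).trans (Quotient.sound (BondRel.hexagon m n p))
  hexagon' m n p := by
    refine (congrArg (fun t => bondGraphData.cast _ _ (bondGraphData.comp _ t))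
      (bondGraphData_cast _ _ _)).trans ?_
    exact (bondGraphData_cast _ _ _).trans (Quotient.sound (BondRel.hexagon' m n p))
  dagger_id n := rfl
  dagger_comp := by rintro m n p ⟨f⟩ ⟨g⟩; rfl
  dagger_dagger := by
    rintro m n ⟨f⟩; exact congrArg (Quotient.mk _) f.dagger_dagger
  dagger_tensor := by rintro m n p q ⟨f⟩ ⟨g⟩; rfl
  dagger_braid m n := rfl

/-- A generator as a bond graph. -/
def BondGraph.of {m n : ℕ} (g : Junction m n) : BondGraph.Hom m n :=
  (⟦Term.gen g⟧ : Quotient (bondSetoid m n))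

/-! ### The morphisms in the statement -/

/-- `m₂` as a morphism of `FinCorelO`. -/
def FinCorelO.m₂ : FinCorelO.Hom 2 1 := ⟨corM₂, .gen _ .m₂⟩

/-- `i₂` as a morphism of `FinCorelO`. -/
def FinCorelO.i₂ : FinCorelO.Hom 0 1 := ⟨corI₂, .gen _ .i₂⟩

/-- `μ₂` as a morphism of `FinCorelO`. -/
def FinCorelO.μ₂ : FinCorelO.Hom 2 1 := ⟨corMu₂, .gen _ .μ₂⟩

/-- `ι₂` as a morphism of `FinCorelO`. -/
def FinCorelO.ι₂ : FinCorelO.Hom 0 1 := ⟨corIota₂, .gen _ .ι₂⟩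

/-- `+ ⊕ Δ†` as a morphism of `LagRelO k`. -/
def LagRelO.addDup (k : Type u) [Field k] : (LagRelO k).Hom 2 1 :=
  ⟨BondGraphs.addDup k, .gen _ .addDup⟩

/-- `0 ⊕ !†` as a morphism of `LagRelO k`. -/
def LagRelO.zeroDel (k : Type u) [Field k] : (LagRelO k).Hom 0 1 :=
  ⟨BondGraphs.zeroDel k, .gen _ .zeroDel⟩

/-- `Δ† ⊕ +` as a morphism of `LagRelO k`. -/
def LagRelO.dupAdd (k : Type u) [Field k] : (LagRelO k).Hom 2 1 :=
  ⟨BondGraphs.dupAdd k, .gen _ .dupAdd⟩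

/-- `!† ⊕ 0` as a morphism of `LagRelO k`. -/
def LagRelO.delZero (k : Type u) [Field k] : (LagRelO k).Hom 0 1 :=
  ⟨BondGraphs.delZero k, .gen _ .delZero⟩

end BondGraphs

universe w

namespace BondGraphs

/-! A morphism of dagger props out of `BondGraph` amounts to values for the eight generators that
satisfy the equations `BondEq` and are compatible with the dagger. Uniqueness is immediate: `D`,
`E`, `D'`, `E'` are the daggers of `M`, `I`, `M'`, `I'`, and every bond graph is the class of an
expression in the generators (`BondGraph.hom_ext`). For existence (`BondGraph.lift`) the equations
have to be verified in the two targets.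

Both targets map faithfully to relations between powers of a set, and a faithful morphism reflects
equations (`DaggerPropHom.bondEq_of_faithful`). In the prop of relations each equation says that two
formulas in finitely many elements are equivalent.

A Lagrangian relation is sent to its underlying relation on pairs (effort, flow). There `M` adds
efforts along a common flow and `M'` adds flows along a common effort (`lagGen_bondEq`).

A corelation is sent to the relation between tuples of propositions that are constant on its parts;
the partition can be recovered from these tuples. The object 2n becomes the n-th power of `Prop ×
Prop` by grouping consecutive entries. The generators then make sense for any set A in place of
`Prop`: `M` is composition (p,q)(q,r) = (p,r) in the pair groupoid of A, `I` is the set of identity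
arrows, and `M'` is the opposite of duplication. The equations hold for every nonempty A
(`pairGen_bondEq`), and `finCorelORel_gen` identifies these relations with the images of the eight
corelations. -/

/-! ### Evaluation of expressions and the universal property of bond graphs -/

/-- The value of an expression in a dagger prop, given the values of the generators. -/
def Term.eval (P : DaggerProp.{u}) (g : ∀ {m n}, Junction m n → P.Hom m n) :
    ∀ {m n}, Term m n → P.Hom m n
  | _, _, gen j => g j
  | _, _, ident n => P.id n
  | _, _, comp s t => P.comp (eval P g s) (eval P g t)
  | _, _, tensor s t => P.tensor (eval P g s) (eval P g t)
  | _, _, braid m n => P.braid m n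

theorem Term.eval_cast (P : DaggerProp.{u}) (g : ∀ {m n}, Junction m n → P.Hom m n)
    {m n m' n' : ℕ} (h : m = m') (h' : n = n') (t : Term m n) :
    (t.cast h h').eval P g = P.cast h h' (t.eval P g) := by
  subst h h'; rfl

/-- The dagger of an expression is defined from that of the generators by the rules that hold in
every dagger prop, so compatibility needs to be known on generators only. -/
theorem Term.eval_dagger (P : DaggerProp.{u}) (g : ∀ {m n}, Junction m n → P.Hom m n)
    (hg : ∀ {m n} (j : Junction m n), g j.dagger = P.dagger (g j)) {m n : ℕ} (t : Term m n) :
    t.dagger.eval P g = P.dagger (t.eval P g) := by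
  induction t with
  | gen j => exact hg j
  | ident n => exact (P.dagger_id n).symm
  | comp s t hs ht => simp only [Term.dagger, Term.eval, P.dagger_comp, hs, ht]
  | tensor s t hs ht => simp only [Term.dagger, Term.eval, P.dagger_tensor, hs, ht]
  | braid m n => exact (P.dagger_braid m n).symm

/-- This carries the two sides of an equation along a morphism of props, which is how equations are
moved to the prop of relations. -/
theorem DaggerPropHom.map_eval {P : DaggerProp.{u}} {Q : DaggerProp.{v}} (Φ : DaggerPropHom P Q)
    (g : ∀ {m n}, Junction m n → P.Hom m n) {m n : ℕ} (t : Term m n) :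
    Φ.map (t.eval P g) = t.eval Q (fun j => Φ.map (g j)) := by
  induction t with
  | gen j => rfl
  | ident n => exact Φ.map_id n
  | comp s t hs ht => simp only [Term.eval, Φ.map_comp, hs, ht]
  | tensor s t hs ht => simp only [Term.eval, Φ.map_tensor, hs, ht]
  | braid m n => exact Φ.map_braid m n

/-- Every clause of the congruence except `eqn` is a rule of equality or a law valid in `P`, so the
defining equations are all that has to be checked. -/
theorem BondRel.eval_eq {P : DaggerProp.{u}} {g : ∀ {m n}, Junction m n → P.Hom m n}
    (hg : ∀ {m n} {s t : Term m n}, BondEq s t → s.eval P g = t.eval P g)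
    {m n : ℕ} {s t : Term m n} (h : BondRel s t) : s.eval P g = t.eval P g := by
  induction h with
  | refl f => rfl
  | symm _ h => exact h.symm
  | trans _ _ h h' => exact h.trans h'
  | comp _ _ h h' => simp only [Term.eval, h, h']
  | tensor _ _ h h' => simp only [Term.eval, h, h']
  | id_comp f => exact P.id_comp _
  | comp_id f => exact P.comp_id _
  | comp_assoc f g h => exact P.comp_assoc _ _ _
  | id_tensor_id m n => exact P.id_tensor_id m n
  | interchange f g f' g' => exact P.interchange _ _ _ _
  | tensor_assoc f g h => exact (Term.eval_cast _ _ _ _ _).trans (P.tensor_assoc _ _ _)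
  | id_tensor f => exact (Term.eval_cast _ _ _ _ _).trans (P.id_tensor _)
  | tensor_id_zero f => exact (Term.eval_cast _ _ _ _ _).trans (P.tensor_id_zero _)
  | braid_natural f g => exact P.braid_natural _ _
  | braid_braid m n => exact P.braid_braid m n
  | hexagon m n p =>
    simpa only [Term.eval_cast, Term.eval] using P.hexagon m n p
  | hexagon' m n p =>
    simpa only [Term.eval_cast, Term.eval] using P.hexagon' m n p
  | eqn h => exact hg h

/-- The morphism of dagger props out of `BondGraph` with given values on the generators. -/
def BondGraph.lift {P : DaggerProp.{u}} (g : ∀ {m n}, Junction m n → P.Hom m n)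
    (hd : ∀ {m n} (j : Junction m n), g j.dagger = P.dagger (g j))
    (hg : ∀ {m n} {s t : Term m n}, BondEq s t → s.eval P g = t.eval P g) :
    DaggerPropHom BondGraph P where
  map {m n} := Quotient.lift (s := bondSetoid m n) (Term.eval P g) fun _ _ h => h.eval_eq hg
  map_id _ := rfl
  map_comp := by rintro m n p ⟨f⟩ ⟨g⟩; rfl
  map_tensor := by rintro m n p q ⟨f⟩ ⟨g⟩; rfl
  map_braid _ _ := rfl
  map_dagger := by rintro m n ⟨f⟩; exact f.eval_dagger P g hd

theorem DaggerPropHom.eq_of_map_eq {P : DaggerProp.{u}} {Q : DaggerProp.{v}}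
    {Φ Ψ : DaggerPropHom P Q}
    (h : ∀ {m n} (f : P.Hom m n), Φ.map f = Ψ.map f) : Φ = Ψ := by
  obtain ⟨φ, _, _, _, _, _⟩ := Φ
  obtain ⟨ψ, _, _, _, _, _⟩ := Ψ
  have : @φ = @ψ := by funext m n f; exact h f
  subst this
  rfl

/-- Morphisms out of `BondGraph` are determined by their values on four of the generators. -/
theorem BondGraph.hom_ext {P : DaggerProp.{u}} {Φ Ψ : DaggerPropHom BondGraph P}
    (hM : Φ.map (BondGraph.of .M) = Ψ.map (BondGraph.of .M))
    (hI : Φ.map (BondGraph.of .I) = Ψ.map (BondGraph.of .I))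
    (hM' : Φ.map (BondGraph.of .M') = Ψ.map (BondGraph.of .M'))
    (hI' : Φ.map (BondGraph.of .I') = Ψ.map (BondGraph.of .I')) : Φ = Ψ := by
  -- Agreement passes to daggers, which covers the four generators that are not among the
  -- hypotheses.
  have hd : ∀ {m n : ℕ} (f : BondGraph.Hom m n), Φ.map f = Ψ.map f →
      Φ.map (BondGraph.dagger f) = Ψ.map (BondGraph.dagger f) := fun f h => by
    rw [Φ.map_dagger, Ψ.map_dagger, h]
  have key : ∀ {m n : ℕ} (t : Term m n),
      Φ.map (Quotient.mk (bondSetoid m n) t) = Ψ.map (Quotient.mk (bondSetoid m n) t) := by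
    intro m n t
    induction t with
    | gen j =>
      cases j
      exacts [hM, hI, hd _ hM, hd _ hI, hM', hI', hd _ hM', hd _ hI']
    | ident n => exact (Φ.map_id n).trans (Ψ.map_id n).symm
    | comp s t hs ht =>
      exact (Φ.map_comp _ _).trans ((congrArg₂ P.comp hs ht).trans (Ψ.map_comp _ _).symm)
    | tensor s t hs ht =>
      exact (Φ.map_tensor _ _).trans ((congrArg₂ P.tensor hs ht).trans (Ψ.map_tensor _ _).symm)
    | braid m n => exact (Φ.map_braid m n).trans (Ψ.map_braid m n).symm
  exact DaggerPropHom.eq_of_map_eq fun f => Quotient.inductionOn f key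

/-! ### Constructions on morphisms of dagger props -/

/-- Composition of morphisms of dagger props. -/
def DaggerPropHom.comp {P : DaggerProp.{u}} {Q : DaggerProp.{v}} {R : DaggerProp.{w}}
    (Φ : DaggerPropHom P Q) (Ψ : DaggerPropHom Q R) : DaggerPropHom P R where
  map f := Ψ.map (Φ.map f)
  map_id n := by rw [Φ.map_id, Ψ.map_id]
  map_comp f g := by rw [Φ.map_comp, Ψ.map_comp]
  map_tensor f g := by rw [Φ.map_tensor, Ψ.map_tensor]
  map_braid m n := by rw [Φ.map_braid, Ψ.map_braid]
  map_dagger f := by rw [Φ.map_dagger, Ψ.map_dagger]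

/-- The inclusion of a sub-prop. -/
def DaggerProp.subIncl (P : DaggerProp.{u}) (S : ∀ m n, P.Hom m n → Prop)
    (hS : ∀ m n f, S m n f → S n m (P.dagger f)) : DaggerPropHom (P.sub S hS) P where
  map f := f.1
  map_id _ := rfl
  map_comp _ _ := rfl
  map_tensor _ _ := rfl
  map_braid _ _ := rfl
  map_dagger _ := rfl

theorem DaggerPropHom.map_cast {P : DaggerProp.{u}} {Q : DaggerProp.{v}} (Φ : DaggerPropHom P Q)
    {m n m' n' : ℕ} (h : m = m') (h' : n = n') (f : P.Hom m n) :
    Φ.map (P.cast h h' f) = Q.cast h h' (Φ.map f) := by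
  subst h h'; rfl

/-- The morphism induced between the props of multiples of an object. -/
def DaggerPropHom.multiples {P : DaggerProp.{u}} {Q : DaggerProp.{v}} (Φ : DaggerPropHom P Q)
    (c : ℕ) : DaggerPropHom (P.multiples c) (Q.multiples c) where
  map {m n} f := Φ.map (m := c * m) (n := c * n) f
  map_id _ := Φ.map_id _
  map_comp _ _ := Φ.map_comp _ _
  map_tensor _ _ := (Φ.map_cast _ _ _).trans (congrArg (Q.cast _ _) (Φ.map_tensor _ _))
  map_braid _ _ := (Φ.map_cast _ _ _).trans (congrArg (Q.cast _ _) (Φ.map_braid _ _))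
  map_dagger _ := Φ.map_dagger _

/-! ### The relations underlying corelations and Lagrangian relations -/

/-- The morphism that sends a corelation to the relation of its invariant predicates. -/
def finCorelRel : DaggerPropHom FinCorel (relProp Prop) where
  map R := finCorelInv R
  map_id n := by
    funext x y
    -- The parts of the identity are the fibres of a map, and a predicate is constant on them
    -- exactly when it takes the same value at each input and the matching output.
    exact propext ((finCorelInv_ker _root_.id x y (Equiv.refl _)).trans funext_iff.symm)
  map_comp := finCorelInv_comp
  map_tensor R S := by
    funext x y
    -- A predicate is invariant under a join exactly when it is invariant under both partitions, and
    -- invariance under a pushed-forward partition is invariance of the pullback.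
    refine propext (sup_le_iff.trans (and_congr ?_ ?_))
    · refine setoid_map_le_ker.trans ?_
      rw [Sum.elim_comp_map]; exact Iff.rfl
    · refine setoid_map_le_ker.trans ?_
      rw [Sum.elim_comp_map]; exact Iff.rfl
  map_braid m n := by
    funext x y
    refine propext ((finCorelInv_ker finAddFlip x y (Equiv.refl _)).trans ?_)
    constructor
    · intro h
      exact ⟨fun i => by simpa using h (Fin.castAdd n i),
        fun i => by simpa using h (Fin.natAdd m i)⟩
    · rintro ⟨h1, h2⟩ i
      induction i using Fin.addCases with
      | left i => simpa using h1 i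
      | right i => simpa using h2 i
  map_dagger {m n} (R : Setoid (Fin m ⊕ Fin n)) := by
    funext y x
    -- Both directions apply the hypothesis at the swapped points; swapping twice gives back the
    -- original ones.
    refine propext ⟨fun h a b hab => ?_, fun h a b hab => ?_⟩
    · have := h (x := a.swap) (y := b.swap)
        (by change R a.swap.swap b.swap.swap; simpa using hab)
      rw [Setoid.ker_def] at this ⊢
      rcases a with a | a <;> rcases b with b | b <;> exact this
    · have := h (x := a.swap) (y := b.swap) hab
      rw [Setoid.ker_def] at this ⊢
      rcases a with a | a <;> rcases b with b | b <;> exact this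

/-- The morphism that sends a Lagrangian relation to its underlying relation. -/
def lagRelRel (k : Type u) [Field k] : DaggerPropHom (LagRel k) (relProp (k × k)) where
  map L x y := (x, y) ∈ L.1
  map_id _ := rfl
  map_comp _ _ := rfl
  map_tensor _ _ := rfl
  map_braid _ _ := rfl
  map_dagger _ := rfl


/-! ### Quantifiers over short tuples -/

/-- A relational composite quantifies over the tuple on the middle object. This lemma and the next
three replace it by its coordinates, which leaves first-order statements about elements. -/
theorem exists_fin_one_pi {X : Type u} {p : (Fin 1 → X) → Prop} :
    (∃ z, p z) ↔ ∃ a, p ![a] := by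
  rw [Fin.exists_fin_succ_pi]; simp only [Fin.exists_fin_zero_pi]; rfl

theorem exists_fin_two_pi {X : Type u} {p : (Fin 2 → X) → Prop} :
    (∃ z, p z) ↔ ∃ a b, p ![a, b] := by
  rw [Fin.exists_fin_succ_pi]; simp only [exists_fin_one_pi]; rfl

theorem exists_fin_three_pi {X : Type u} {p : (Fin 3 → X) → Prop} :
    (∃ z, p z) ↔ ∃ a b c, p ![a, b, c] := by
  rw [Fin.exists_fin_succ_pi]; simp only [exists_fin_two_pi]; rfl

theorem exists_fin_four_pi {X : Type u} {p : (Fin 4 → X) → Prop} :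
    (∃ z, p z) ↔ ∃ a b c d, p ![a, b, c, d] := by
  rw [Fin.exists_fin_succ_pi]; simp only [exists_fin_three_pi]; rfl

/-! ### Tuples of even length as tuples of pairs -/

section Pairs

variable {A : Type u}

/-- A tuple of pairs as a tuple of twice the length. -/
def flattenPairs {n : ℕ} (x : Fin n → A × A) (i : Fin (2 * n)) : A :=
  if i.1 % 2 = 0 then (x ⟨i.1 / 2, by omega⟩).1 else (x ⟨i.1 / 2, by omega⟩).2

/-- The inverse reads the entries at `2 * j` and `2 * j + 1` as the j-th pair. Injectivity gives
preservation of identities by `relPairs`; surjectivity gives preservation of composites and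
faithfulness. -/
theorem flattenPairs_bijective (n : ℕ) :
    Function.Bijective (flattenPairs : (Fin n → A × A) → Fin (2 * n) → A) := by
  refine Function.bijective_iff_has_inverse.2
    ⟨fun z j => (z ⟨2 * j.1, by omega⟩, z ⟨2 * j.1 + 1, by omega⟩), fun x => ?_, fun z => ?_⟩
  · funext j
    have h : (2 * j.1 + 1) / 2 = j.1 := by omega
    simp [flattenPairs, Nat.add_mod, h]
  · funext i
    unfold flattenPairs
    split <;> exact congrArg z (Fin.ext (by dsimp only; omega))

/-- A shift by `2 * m` keeps the parity and moves the index of the pair by `m`. The analogue for the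
first block holds by definition. -/
theorem flattenPairs_natAdd {m n : ℕ} (x : Fin (m + n) → A × A) (i : Fin (2 * n)) :
    flattenPairs x (Fin.cast (Nat.mul_add 2 m n).symm (Fin.natAdd (2 * m) i))
      = flattenPairs (fun j => x (Fin.natAdd m j)) i := by
  have h : (2 * m + i.1) / 2 = m + i.1 / 2 := by omega
  simp [flattenPairs, Nat.add_mod, h, Fin.natAdd]

variable (A)

/-- Relations between tuples of even length, as relations between tuples of pairs. -/
def relPairs : DaggerPropHom ((relProp A).multiples 2) (relProp (A × A)) where
  map R x y := R (flattenPairs x) (flattenPairs y)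
  map_id n := by
    funext x y
    exact propext (flattenPairs_bijective n).1.eq_iff
  map_comp {m n p} R S := by
    funext x y
    -- Every middle tuple of length `2 * n` comes from a tuple of pairs, by surjectivity.
    exact propext ((flattenPairs_bijective n).2.exists
      (p := fun z => R (flattenPairs x) z ∧ S z (flattenPairs y)))
  map_tensor {m n p q} R S := by
    funext x y
    -- The tensor product on multiples is transported along `2 * (m + p) = 2 * m + 2 * p`; for
    -- relations this is a reindexing of the tuples.
    refine (congrFun (congrFun (relData_cast _ _ _) _) _).trans ?_
    have h1 : (fun i : Fin (2 * p) =>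
        flattenPairs x (Fin.cast (Nat.mul_add 2 m p).symm (Fin.natAdd (2 * m) i)))
        = flattenPairs (fun j => x (Fin.natAdd m j)) := funext fun i => flattenPairs_natAdd x i
    have h2 : (fun i : Fin (2 * q) =>
        flattenPairs y (Fin.cast (Nat.mul_add 2 n q).symm (Fin.natAdd (2 * n) i)))
        = flattenPairs (fun j => y (Fin.natAdd n j)) := funext fun i => flattenPairs_natAdd y i
    change (R _ _ ∧ S (fun i : Fin (2 * p) =>
        flattenPairs x (Fin.cast (Nat.mul_add 2 m p).symm (Fin.natAdd (2 * m) i)))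
        (fun i : Fin (2 * q) =>
        flattenPairs y (Fin.cast (Nat.mul_add 2 n q).symm (Fin.natAdd (2 * n) i)))) = _
    rw [h1, h2]
    rfl
  map_braid m n := by
    funext x y
    refine (congrFun (congrFun (relData_cast _ _ _) _) _).trans (propext ?_)
    -- Both swaps are compared with equality of whole flattened blocks: entrywise this is the swap
    -- of even blocks, and by injectivity it is the swap of blocks of pairs.
    refine Iff.trans (b := flattenPairs (fun j => x (Fin.castAdd n j))
        = flattenPairs (fun j => y (Fin.natAdd n j)) ∧
      flattenPairs (fun j => x (Fin.natAdd m j)) = flattenPairs (fun j => y (Fin.castAdd m j))) ?_ ?_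
    · rw [funext_iff, funext_iff]
      refine and_congr (forall_congr' fun i => ?_) (forall_congr' fun i => ?_)
      · exact (Eq.congr_right (flattenPairs_natAdd y i))
      · exact (Eq.congr_left (flattenPairs_natAdd x i))
    · rw [(flattenPairs_bijective _).1.eq_iff, (flattenPairs_bijective _).1.eq_iff, funext_iff,
        funext_iff]
      rfl
  map_dagger _ := rfl

/-! ### The bond graph equations in the pair groupoid -/

/-- The relations between tuples of pairs that correspond to the eight generators of
`FinCorelO`. -/
def pairGen : ∀ {m n}, Junction m n → (relProp (A × A)).Hom m n
  | _, _, .M => fun x y => (x 0).1 = (y 0).1 ∧ (x 0).2 = (x 1).1 ∧ (x 1).2 = (y 0).2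
  | _, _, .I => fun _ y => (y 0).1 = (y 0).2
  | _, _, .D => fun y x => (x 0).1 = (y 0).1 ∧ (x 0).2 = (x 1).1 ∧ (x 1).2 = (y 0).2
  | _, _, .E => fun y _ => (y 0).1 = (y 0).2
  | _, _, .M' => fun x y => x 0 = y 0 ∧ x 1 = y 0
  | _, _, .I' => fun _ _ => True
  | _, _, .D' => fun y x => x 0 = y 0 ∧ x 1 = y 0
  | _, _, .E' => fun _ _ => True

-- The weak bimonoid laws for `M`, `I`, `D'`, `E'` hold because duplication respects composition of
-- arrows, three arrows are composable exactly when consecutive ones are, and two identity arrows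
-- are composable exactly when they are equal. The laws for `M'`, `I'`, `D`, `E` are the opposite
-- ones. Both `loop` and `loop'` are the partial identity on the diagonal, hence idempotent. The
-- laws with empty source and target, such as `extra`, assert that some pair exists; they need A to
-- be nonempty.
set_option maxHeartbeats 1000000 in
theorem pairGen_bondEq [Nonempty A] {m n : ℕ} {s t : Term m n} (h : BondEq s t) :
    s.eval (relProp (A × A)) (pairGen A) = t.eval (relProp (A × A)) (pairGen A) := by
  rcases h with ⟨_, _, h⟩ | ⟨_, _, h⟩ | ⟨_, _, h⟩ | ⟨_, _, h⟩ | _ | _ | _ | _ <;> try cases h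
  all_goals
    funext x y
    -- The lengths of the tuples become numerals, as the lemmas on short tuples expect.
    try simp only [Nat.reduceAdd] at x y
    simp [Term.eval, pairGen, relProp, relData, exists_fin_one_pi, exists_fin_two_pi,
      exists_fin_three_pi, exists_fin_four_pi, Term.loop, Term.loop', Fin.castAdd, Fin.natAdd,
      funext_iff, Fin.forall_fin_succ, Prod.ext_iff]
    try grind

end Pairs

/-! ### The bond graph equations for efforts and flows -/

/-- The relations underlying the eight generators of `LagRelO k`. -/
def lagGen (k : Type u) [Field k] : ∀ {m n}, Junction m n → (relProp (k × k)).Hom m n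
  | _, _, .M => fun x y => (y 0).1 = (x 0).1 + (x 1).1 ∧ (x 0).2 = (y 0).2 ∧ (x 1).2 = (y 0).2
  | _, _, .I => fun _ y => (y 0).1 = 0
  | _, _, .D => fun y x => (y 0).1 = (x 0).1 + (x 1).1 ∧ (x 0).2 = (y 0).2 ∧ (x 1).2 = (y 0).2
  | _, _, .E => fun y _ => (y 0).1 = 0
  | _, _, .M' => fun x y => ((x 0).1 = (y 0).1 ∧ (x 1).1 = (y 0).1) ∧ (y 0).2 = (x 0).2 + (x 1).2
  | _, _, .I' => fun _ y => (y 0).2 = 0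
  | _, _, .D' => fun y x => ((x 0).1 = (y 0).1 ∧ (x 1).1 = (y 0).1) ∧ (y 0).2 = (x 0).2 + (x 1).2
  | _, _, .E' => fun y _ => (y 0).2 = 0

-- Efforts and flows do not interact. In `M`, `I`, `D'`, `E'` the efforts carry the bimonoid of
-- addition and duplication and the flows carry its opposite, so even the full bimonoid laws hold.
-- The relation `loop` from (φ, J) to (φ', J') says that 2φ = 2φ' and J = J' = 2c for some c, and
-- `loop'` exchanges the two roles. If 2 is invertible this is the identity; in characteristic 2 it
-- forces J = J' = 0 and leaves φ, φ' free. Either way it is idempotent.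
set_option maxHeartbeats 1000000 in
theorem lagGen_bondEq (k : Type u) [Field k] {m n : ℕ} {s t : Term m n} (h : BondEq s t) :
    s.eval (relProp (k × k)) (lagGen k) = t.eval (relProp (k × k)) (lagGen k) := by
  rcases h with ⟨_, _, h⟩ | ⟨_, _, h⟩ | ⟨_, _, h⟩ | ⟨_, _, h⟩ | _ | _ | _ | _ <;> try cases h
  all_goals
    funext x y
    try simp only [Nat.reduceAdd] at x y
    simp [Term.eval, lagGen, relProp, relData, exists_fin_one_pi, exists_fin_two_pi,
      exists_fin_three_pi, exists_fin_four_pi, Term.loop, Term.loop', Fin.castAdd, Fin.natAdd,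
      funext_iff, Fin.forall_fin_succ, Prod.ext_iff]
    try grind
  -- What remains are the two Frobenius laws and the special law, for 1-junctions and then for
  -- 0-junctions, each asking for a value on an inner bond. In a Frobenius law it is the part of the
  -- split input that does not leave through its own output, a difference; in the special law the
  -- input is split as itself plus zero.
  · exact ⟨by grind, fun _ => ⟨(x 0).1 - (y 0).1, by grind⟩⟩
  · exact ⟨by grind, fun _ => ⟨(x 1).1 - (y 1).1, by grind⟩⟩
  · exact ⟨by grind, fun _ => ⟨(x 0).1, 0, by grind⟩⟩
  · exact ⟨by grind, fun _ => ⟨(x 0).2 - (y 0).2, by grind⟩⟩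
  · exact ⟨by grind, fun _ => ⟨(x 1).2 - (y 1).2, by grind⟩⟩
  · exact ⟨by grind, fun _ => ⟨(x 0).2, 0, by grind⟩⟩



/-! ### Faithful morphisms to relations: the Lagrangian case -/

/-- A morphism to another dagger prop that is faithful reflects the equations of bond graphs. -/
theorem DaggerPropHom.bondEq_of_faithful {P : DaggerProp.{u}} {Q : DaggerProp.{v}}
    (Φ : DaggerPropHom P Q) (hΦ : ∀ {m n} {f f' : P.Hom m n}, Φ.map f = Φ.map f' → f = f')
    {g : ∀ {m n}, Junction m n → P.Hom m n} {g' : ∀ {m n}, Junction m n → Q.Hom m n}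
    (hg : ∀ {m n} (j : Junction m n), Φ.map (g j) = g' j)
    (h : ∀ {m n} {s t : Term m n}, BondEq s t → s.eval Q g' = t.eval Q g')
    {m n : ℕ} {s t : Term m n} (hst : BondEq s t) : s.eval P g = t.eval P g := by
  have e : (fun {m n} (j : Junction m n) => Φ.map (g j)) = @g' := by
    funext m n j; exact hg j
  refine hΦ ?_
  rw [Φ.map_eval, Φ.map_eval, e]
  exact h hst

/-- The eight generators of `LagRelO k`. -/
def lagRelOGen (k : Type u) [Field k] : ∀ {m n}, Junction m n → (LagRelO k).Hom m n
  | _, _, .M => LagRelO.addDup k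
  | _, _, .I => LagRelO.zeroDel k
  | _, _, .D => ⟨addDup' k, .gen _ .addDup'⟩
  | _, _, .E => ⟨zeroDel' k, .gen _ .zeroDel'⟩
  | _, _, .M' => LagRelO.dupAdd k
  | _, _, .I' => LagRelO.delZero k
  | _, _, .D' => ⟨dupAdd' k, .gen _ .dupAdd'⟩
  | _, _, .E' => ⟨delZero' k, .gen _ .delZero'⟩

/-- The morphism that sends a morphism of `LagRelO k` to its underlying relation. -/
def lagRelORel (k : Type u) [Field k] : DaggerPropHom (LagRelO k) (relProp (k × k)) :=
  ((LagRel k).subIncl (IsLagGen k) (isLagGen_dagger k)).comp (lagRelRel k)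

theorem lagRelORel_faithful (k : Type u) [Field k] {m n : ℕ} {f f' : (LagRelO k).Hom m n}
    (h : (lagRelORel k).map f = (lagRelORel k).map f') : f = f' :=
  Subtype.ext <| Subtype.ext <| Submodule.ext fun ⟨x, y⟩ => iff_of_eq (congrFun (congrFun h x) y)

theorem lagRelORel_gen (k : Type u) [Field k] {m n : ℕ} (j : Junction m n) :
    (lagRelORel k).map (lagRelOGen k j) = lagGen k j := by
  funext x y
  cases j
  · rfl
  -- The condition on flows comes from `!†`, which is everything, so only the condition on efforts
  -- survives.
  · exact propext (and_iff_left trivial)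
  · rfl
  · exact propext (and_iff_left trivial)
  · rfl
  · exact propext (and_iff_right trivial)
  · rfl
  · exact propext (and_iff_right trivial)

/-! ### Faithful morphisms to relations: the case of corelations -/

/-- The eight generators of `FinCorelO`. -/
def finCorelOGen : ∀ {m n}, Junction m n → FinCorelO.Hom m n
  | _, _, .M => FinCorelO.m₂
  | _, _, .I => FinCorelO.i₂
  | _, _, .D => ⟨corD₂, .gen _ .d₂⟩
  | _, _, .E => ⟨corE₂, .gen _ .e₂⟩
  | _, _, .M' => FinCorelO.μ₂
  | _, _, .I' => FinCorelO.ι₂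
  | _, _, .D' => ⟨corDelta₂, .gen _ .δ₂⟩
  | _, _, .E' => ⟨corEps₂, .gen _ .ε₂⟩

theorem finCorelOGen_dagger {m n : ℕ} (j : Junction m n) :
    finCorelOGen j.dagger = FinCorelO.dagger (finCorelOGen j) := by
  cases j
  exacts [Subtype.ext corM₂_dagger.symm, Subtype.ext corI₂_dagger.symm,
    Subtype.ext corD₂_dagger.symm, Subtype.ext corE₂_dagger.symm,
    Subtype.ext corMu₂_dagger.symm, Subtype.ext corIota₂_dagger.symm,
    Subtype.ext corDelta₂_dagger.symm, Subtype.ext corEps₂_dagger.symm]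

/-- The morphism that sends a morphism of `FinCorelO` to the relation of its invariant
predicates. -/
def finCorelORel : DaggerPropHom FinCorelO (relProp (Prop × Prop)) :=
  (((FinCorel.multiples 2).subIncl IsCorelGen isCorelGen_dagger).comp
    (finCorelRel.multiples 2)).comp (relPairs Prop)

/-- A partition is determined by the predicates constant on its parts, and every predicate on an
even number of points comes from a tuple of pairs. -/
theorem finCorelORel_faithful {m n : ℕ} {f f' : FinCorelO.Hom m n}
    (h : finCorelORel.map f = finCorelORel.map f') : f = f' := by
  refine Subtype.ext (finCorelInv_injective ?_)
  funext x y
  obtain ⟨x, rfl⟩ := (flattenPairs_bijective m).2 x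
  obtain ⟨y, rfl⟩ := (flattenPairs_bijective n).2 y
  exact congrFun (congrFun h x) y

/-- The corelations `corM`, `corI`, `corD`, `corE` are all `⊤`, and the eight generators are built
from them by the operations of a prop; so this is the only partition whose invariants are computed
by hand. -/
theorem finCorelInv_top {m n : ℕ} (x : Fin m → Prop) (y : Fin n → Prop) :
    finCorelInv ⊤ x y ↔ ∀ a b, Sum.elim x y a = Sum.elim x y b :=
  ⟨fun h a b => h (x := a) (y := b) trivial, fun h _ _ _ => h _ _⟩

theorem finCorelRel_corM : finCorelRel.map corM = fun x y => x 0 = y 0 ∧ x 1 = y 0 := by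
  funext x y
  refine propext ((finCorelInv_top x y).trans ?_)
  simp only [Sum.forall, Fin.forall_fin_succ, Fin.forall_fin_zero, Sum.elim_inl, Sum.elim_inr]
  grind

theorem finCorelRel_corI : finCorelRel.map corI = fun _ _ => True := by
  funext x y
  refine propext ((finCorelInv_top x y).trans ?_)
  simp [Fin.forall_fin_succ]

theorem finCorelRel_corD : finCorelRel.map corD = fun y x => x 0 = y 0 ∧ x 1 = y 0 :=
  (finCorelRel.map_dagger corM).trans (congrArg (relProp Prop).dagger finCorelRel_corM)

theorem finCorelRel_corE : finCorelRel.map corE = fun _ _ => True :=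
  (finCorelRel.map_dagger corI).trans (congrArg (relProp Prop).dagger finCorelRel_corI)

theorem finCorelORel_apply {m n : ℕ} (f : FinCorelO.Hom m n) (x : Fin m → Prop × Prop)
    (y : Fin n → Prop × Prop) : finCorelORel.map f x y
      = (finCorelRel.map (m := 2 * m) (n := 2 * n) f.1) (flattenPairs x) (flattenPairs y) := rfl

/-- The invariants are computed from those of one-part corelations by functoriality. Joining and
capping the two inner of four points, as `corM₂` does, composes pairs (p,q), (q,r) to (p,r); sorting
the points before joining, as `corMu₂` does, identifies two pairs componentwise. -/
theorem finCorelORel_gen {m n : ℕ} (j : Junction m n) :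
    finCorelORel.map (finCorelOGen j) = pairGen Prop j := by
  have hM : finCorelORel.map (finCorelOGen .M) = pairGen Prop .M := by
    funext x y
    rw [finCorelORel_apply]
    -- The generator is viewed in `FinCorel` again, between the objects 4 and 2, so that its
    -- expression by tensor products and composites can be mapped term by term.
    change finCorelRel.map corM₂ _ _ = _
    simp only [corM₂, finCorelRel.map_tensor, finCorelRel.map_comp, finCorelRel.map_id,
      finCorelRel_corM, finCorelRel_corE]
    -- The entries of the tuples are propositions; their equations are kept as equations and not
    -- turned into equivalences, so that propositions act as mere elements of a set.
    simp [-eq_iff_iff, relProp, relData, pairGen, flattenPairs, funext_iff, Fin.forall_fin_succ,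
      exists_fin_one_pi, Fin.castAdd, Fin.natAdd]
    grind
  have hI : finCorelORel.map (finCorelOGen .I) = pairGen Prop .I := by
    funext x y
    rw [finCorelORel_apply]
    change finCorelRel.map corI₂ _ _ = _
    simp only [corI₂, finCorelRel.map_comp, finCorelRel_corI, finCorelRel_corD]
    simp [-eq_iff_iff, relProp, relData, pairGen, flattenPairs, exists_fin_one_pi]
    exact propext eq_comm
  have hM' : finCorelORel.map (finCorelOGen .M') = pairGen Prop .M' := by
    funext x y
    rw [finCorelORel_apply]
    change finCorelRel.map corMu₂ _ _ = _
    simp only [corMu₂, corSwap, finCorelRel.map_tensor, finCorelRel.map_comp, finCorelRel.map_id,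
      finCorelRel.map_braid, finCorelRel_corM]
    simp [-eq_iff_iff, relProp, relData, pairGen, flattenPairs, funext_iff, Fin.forall_fin_succ,
      exists_fin_four_pi, Fin.castAdd, Fin.natAdd, Prod.ext_iff]
    grind
  have hI' : finCorelORel.map (finCorelOGen .I') = pairGen Prop .I' := by
    funext x y
    rw [finCorelORel_apply]
    change finCorelRel.map corIota₂ _ _ = _
    simp only [corIota₂, finCorelRel.map_tensor, finCorelRel_corI]
    simp [relProp, relData, pairGen]
  -- The other four generators follow by taking daggers, since the opposite of `pairGen` at a
  -- generator is `pairGen` at its reflection by definition.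
  have hd : ∀ {m n} (j : Junction m n), finCorelORel.map (finCorelOGen j) = pairGen Prop j →
      finCorelORel.map (finCorelOGen j.dagger) = (relProp (Prop × Prop)).dagger (pairGen Prop j) :=
    fun j h => by rw [finCorelOGen_dagger, finCorelORel.map_dagger, h]
  cases j
  exacts [hM, hI, hd _ hM, hd _ hI, hM', hI', hd _ hM', hd _ hI']

end BondGraphs

/-! ### The two morphisms -/

theorem mainTheorem7 (k : Type*) [Field k] :
    (∃! G : BondGraphs.DaggerPropHom BondGraphs.BondGraph BondGraphs.FinCorelO,
      G.map (BondGraphs.BondGraph.of .M) = BondGraphs.FinCorelO.m₂ ∧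
      G.map (BondGraphs.BondGraph.of .I) = BondGraphs.FinCorelO.i₂ ∧
      G.map (BondGraphs.BondGraph.of .M') = BondGraphs.FinCorelO.μ₂ ∧
      G.map (BondGraphs.BondGraph.of .I') = BondGraphs.FinCorelO.ι₂) ∧
    (∃! F : BondGraphs.DaggerPropHom BondGraphs.BondGraph (BondGraphs.LagRelO k),
      F.map (BondGraphs.BondGraph.of .M) = BondGraphs.LagRelO.addDup k ∧
      F.map (BondGraphs.BondGraph.of .I) = BondGraphs.LagRelO.zeroDel k ∧
      F.map (BondGraphs.BondGraph.of .M') = BondGraphs.LagRelO.dupAdd k ∧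
      F.map (BondGraphs.BondGraph.of .I') = BondGraphs.LagRelO.delZero k) := by
  constructor
  · refine ⟨BondGraphs.BondGraph.lift BondGraphs.finCorelOGen BondGraphs.finCorelOGen_dagger
      (BondGraphs.finCorelORel.bondEq_of_faithful BondGraphs.finCorelORel_faithful
        BondGraphs.finCorelORel_gen (BondGraphs.pairGen_bondEq Prop)),
      ⟨rfl, rfl, rfl, rfl⟩, ?_⟩
    rintro G ⟨hM, hI, hM', hI'⟩
    exact BondGraphs.BondGraph.hom_ext hM hI hM' hI'
  -- Here compatibility with the dagger holds by definition: each of the four remaining relations is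
  -- literally the opposite of one of the first four.
  · refine ⟨BondGraphs.BondGraph.lift (BondGraphs.lagRelOGen k) (fun j => by cases j <;> rfl)
      ((BondGraphs.lagRelORel k).bondEq_of_faithful (BondGraphs.lagRelORel_faithful k)
        (BondGraphs.lagRelORel_gen k) (BondGraphs.lagGen_bondEq k)),
      ⟨rfl, rfl, rfl, rfl⟩, ?_⟩
    rintro F ⟨hM, hI, hM', hI'⟩
    exact BondGraphs.BondGraph.hom_ext hM hI hM' hI'
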